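/- **Setting.** Let $d\ge 1$ and let $\mathcal A\subset\mathbf R^d$ be a set of $K$ arms with $\|a\|_2\le 1$ for $a\in\mathcal A$; let $\|\theta^\star\|_2\le1$, and let $T\ge1$, $B\ge 1$ be the horizon and the number of batches, $KT\ge 2$. Playing $a_t\in\mathcal A$ in round $t\le T$ gives the reward $r_t=\langle a_t,\theta^\star\rangle+\mu_t$, where $\mu_1,\mu_2,\dots$ are independent, $\mathbf E\mu_t=0$ and $\mathbf E e^{\lambda\mu_t}\le e^{\lambda^2/2}$ for all $\lambda\in\mathbf R$. The rewards of a batch are observed only after the whole batch has been played. The expected regret is $\mathbf E[\mathrm{Regret}]=T\max_{a\in\mathcal A}\langle a,\theta^\star\rangle-\mathbf E\sum_{t=1}^T\langle a_t,\theta^\star\rangle$. **Designs.** For a finite sequence $S=(a_1,\dots,a_n)$ of arms with rewards $r_1,\dots,r_n$ the least-squares estimate is $\widehat\theta=(\sum_j a_ja_j^{\mathsf T})^{-1}\sum_j r_ja_j$, where the inverse is taken in the span of $S$. Let $0<c\le C$. For a non-empty finite $A\subset\mathbf R^d$, whose span has dimension $\rho$, and $\varepsilon,\delta>0$, a $(c,C)$-*design*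 is a multi-set $S$ of elements of $A$ with the same span as $A$ such that (a) $c\,\rho\,\frac{\log(1/\delta)}{\varepsilon^2}\le |S|\le C\max\{\rho,\ d\,\frac{\log(1/\delta)}{\varepsilon^2}\}$, and (b) for all $\theta^\star$ in the unit ball and all independent zero-mean $1$-subgaussian noises, if the arms in $S$ are played, then for each $a\in A$ we have $|\langle a,\widehat\theta-\theta^\star\rangle|\le\varepsilon$ with probability at least $1-\delta$. A $(c,C)$-*design rule* (in dimension $d$) is a function that returns a $(c,C)$-design for all non-empty finite $A\subset\mathbf R^d$, $\varepsilon>0$ and $0<\delta\le\frac12$. **Algorithm** (for a $(c,C)$-design rule). Let $q=(T/c)^{1/B}$, $\delta=1/(KT^2)$, $\varepsilon_i=\sqrt{d\log(KT^2)/q^i}$; set $A=\mathcal A$, $\widehat\theta=0$. For $i=1,\dots,B-1$: take the design $S$ given by the rule for $A,\varepsilon_i,\delta$; if $|S|$ exceeds the number of remaining rounds, leave the loop; otherwise play $S$ as the $i$-th batch, let $\widehat\theta$ be the least-squares estimate from the rewards of this batch, and remove from $A$ every $a$ with $\langle a,\widehat\theta\rangle<\max_{b\in A}\langle b,\widehat\theta\rangle-2\varepsilon_i$.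 After the loop, play in all remaining rounds (the last batch) an element of $A$ that maximizes $\langle a,\widehat\theta\rangle$ (ties are broken by any fixed rule). **Theorem.** 1. There are absolute constants $0<c\le C$ such that in every dimension $d$ there is a $(c,C)$-design rule; its designs can moreover be taken approximately G-optimal: $|S|\cdot a^{\mathsf T}\big(\sum_{s\in S}ss^{\mathsf T}\big)^{-1}a\le 2\rho$ for all $a\in A$. 2. For all $0<c\le C$ and $\kappa>0$ there is a constant $M=M(c,C,\kappa)$ such that in the above setting, for every $(c,C)$-design rule, the algorithm plays exactly $T$ rounds in at most $B$ batches and, if $B\le\kappa(1+\log T)$, $$\mathbf E[\mathrm{Regret}]\le M\,T^{1/B}\sqrt{dT\log(KT)} .$$ For arbitrary $B\ge1$ the same bound (with $M$ depending only on $c$ and $C$), with at most $B$ batches, holds for the algorithm run with $\min\{B,\,1+\lfloor\log T\rfloor\}$ in place of $B$. -/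

import Mathlib

open MeasureTheory ProbabilityTheory

noncomputable section

namespace BatchedLinearBandit

/-- Arms and parameters are vectors of Euclidean space `ℝ^d`. -/
abbrev Vec (d : ℕ) := EuclideanSpace ℝ (Fin d)

/-- The law `ν` on `ℝ` is that of a zero-mean `1`-subgaussian noise:
`E x = 0` and `E exp (l x) ≤ exp (l ^ 2 / 2)` for all real `l`. -/
def IsNoiseLaw (ν : Measure ℝ) : Prop :=
  IsProbabilityMeasure ν ∧ ∫ x, x ∂ν = 0 ∧ HasSubgaussianMGF (fun x : ℝ => x) 1 ν

variable {d : ℕ}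

/-- The matrix `∑ a aᵀ` of a finite sequence of arms, as an operator. -/
def gram (S : List (Vec d)) : Vec d →L[ℝ] Vec d :=
  ∑ j : Fin S.length, (innerSL ℝ (S.get j)).smulRight (S.get j)

/-- The span of a finite sequence of arms. -/
def spanOf (S : List (Vec d)) : Submodule ℝ (Vec d) := Submodule.span ℝ {a | a ∈ S}

/-- The inverse of `gram S` on the span of `S`. The operator that is inverted acts as `gram S` on
the span of `S` and as the identity on its orthogonal complement; if `S` spans the whole space,
this is the ordinary inverse of `gram S`. -/
def gramInv (S : List (Vec d)) : Vec d →L[ℝ] Vec d :=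
  Ring.inverse (gram S + (spanOf S)ᗮ.starProjection)

/-- The least-squares estimate `(∑ a aᵀ)⁻¹ (∑ r a)`, computed in the span of the played arms. -/
def leastSquares (S : List (Vec d)) (r : Fin S.length → ℝ) : Vec d :=
  gramInv S (∑ j, r j • S.get j)

theorem gram_apply (S : List (Vec d)) (x : Vec d) :
    gram S x = ∑ j : Fin S.length, inner ℝ (S.get j) x • S.get j := by
  simp [gram]

/-- The operator inverted in `gramInv` is always invertible. -/
theorem isUnit_gram_add (S : List (Vec d)) :
    IsUnit (gram S + (spanOf S)ᗮ.starProjection) := by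
  rw [ContinuousLinearMap.isUnit_iff_isUnit_toLinearMap, LinearMap.isUnit_iff_ker_eq_bot,
    LinearMap.ker_eq_bot']
  intro x hx
  have h0 : inner ℝ x ((gram S + (spanOf S)ᗮ.starProjection) x) = 0 := by
    have : (gram S + (spanOf S)ᗮ.starProjection) x = 0 := hx
    rw [this, inner_zero_right]
  rw [add_apply, inner_add_right, gram_apply, inner_sum] at h0
  have hp : inner ℝ x ((spanOf S)ᗮ.starProjection x)
      = ‖(spanOf S)ᗮ.starProjection x‖ ^ 2 := by
    rw [← Submodule.inner_starProjection_left_eq_right,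
      ← real_inner_self_eq_norm_sq, Submodule.inner_starProjection_left_eq_right,
      Submodule.inner_starProjection_left_eq_right]
    congr 1
    exact ((spanOf S)ᗮ.starProjection_eq_self_iff.2
      ((spanOf S)ᗮ.starProjection_apply_mem x)).symm
  have hs : ∀ j : Fin S.length, inner ℝ x (inner ℝ (S.get j) x • S.get j)
      = (inner ℝ (S.get j) x : ℝ) ^ 2 := by
    intro j
    rw [real_inner_smul_right, real_inner_comm (S.get j) x, sq]
  simp only [hs, hp] at h0
  have h1 : (∑ j : Fin S.length, (inner ℝ (S.get j) x : ℝ) ^ 2) = 0 := by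
    have := Finset.sum_nonneg (s := Finset.univ)
      (fun (j : Fin S.length) _ => sq_nonneg (inner ℝ (S.get j) x : ℝ))
    nlinarith [sq_nonneg ‖(spanOf S)ᗮ.starProjection x‖]
  have h2 : (spanOf S)ᗮ.starProjection x = 0 := by
    rw [h1, zero_add] at h0
    exact norm_eq_zero.1 (pow_eq_zero_iff two_ne_zero |>.1 h0)
  have h3 : x ∈ (spanOf S)ᗮ := by
    rw [Submodule.mem_orthogonal]
    intro u hu
    induction hu using Submodule.span_induction with
    | mem y hy =>
      obtain ⟨j, rfl⟩ := List.get_of_mem hy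
      have := (Finset.sum_eq_zero_iff_of_nonneg
        (fun (j : Fin S.length) _ => sq_nonneg (inner ℝ (S.get j) x : ℝ))).1 h1 j
        (Finset.mem_univ j)
      exact pow_eq_zero_iff two_ne_zero |>.1 this
    | zero => simp
    | add y z _ _ hy hz => rw [inner_add_left, hy, hz, add_zero]
    | smul t y _ hy => rw [real_inner_smul_left, hy, mul_zero]
  rw [← (spanOf S)ᗮ.starProjection_eq_self_iff.2 h3, h2]

/-- For a spanning sequence of arms `gramInv` is the ordinary inverse of `∑ a aᵀ`. -/
theorem gramInv_of_span_eq_top (S : List (Vec d)) (h : spanOf S = ⊤) :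
    gramInv S = Ring.inverse (gram S) := by
  simp [gramInv, h]

/-- `rk A` is the dimension of the span of `A`. -/
def rk (A : Finset (Vec d)) : ℕ := Module.finrank ℝ (Submodule.span ℝ (A : Set (Vec d)))

/-- Performing the arms `S`, the least-squares estimate determines the mean reward of each
`a ∈ A` up to `ε`, with probability at least `1 - δ` (for each `a`), whatever the parameter in the
unit ball and the laws of the independent zero-mean `1`-subgaussian noises are. -/
def IsAccurate (A : Finset (Vec d)) (ε δ : ℝ) (S : List (Vec d)) : Prop :=
  ∀ θ : Vec d, ‖θ‖ ≤ 1 → ∀ ν : Fin S.length → Measure ℝ, (∀ j, IsNoiseLaw (ν j)) →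
    ∀ a ∈ A, 1 - δ ≤ (Measure.pi ν).real
      {x | |inner ℝ a (leastSquares S (fun j => inner ℝ (S.get j) θ + x j) - θ)| ≤ ε}

/-- An admissible multi-set (listed in some order) for the action set `A`, accuracy `ε` and
confidence `δ`: it consists of arms of `A`, spans the same space as `A`, is accurate, and has size
`Θ(d log(1/δ) / ε²)` with constants `c` and `C`. Here `rk A = d` if `A` spans `ℝ^d`; the maximum
only leaves room for the `rk A` arms that any spanning multi-set has. -/
structure IsDesign (c C : ℝ) (A : Finset (Vec d)) (ε δ : ℝ) (S : List (Vec d)) : Prop where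
  mem : ∀ a ∈ S, a ∈ A
  span_eq : spanOf S = Submodule.span ℝ (A : Set (Vec d))
  accurate : IsAccurate A ε δ S
  le_length : c * (rk A * (Real.log (1 / δ) / ε ^ 2)) ≤ S.length
  length_le : (S.length : ℝ) ≤ C * max (rk A : ℝ) (d * (Real.log (1 / δ) / ε ^ 2))

/-- A procedure that returns an admissible multi-set for all `A`, `ε` and `δ`. -/
def IsDesignRule (c C : ℝ) (D : Finset (Vec d) → ℝ → ℝ → List (Vec d)) : Prop :=
  ∀ A : Finset (Vec d), A.Nonempty → ∀ ε δ : ℝ, 0 < ε → 0 < δ → δ ≤ 1 / 2 →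
    IsDesign c C A ε δ (D A ε δ)

/-- The uniform distribution on the multi-set `S` is a G-optimal design for `A` up to a factor
`2`: the maximum over `a ∈ A` of `aᵀ (1/n ∑ s sᵀ)⁻¹ a` is at most twice its optimal value `rk A`. -/
def IsApproxGOptimal (A : Finset (Vec d)) (S : List (Vec d)) : Prop :=
  spanOf S = Submodule.span ℝ (A : Set (Vec d)) ∧
    ∀ a ∈ A, (S.length : ℝ) * inner ℝ a (gramInv S a) ≤ 2 * rk A

/-- The input of the algorithm: action set, horizon, number of batches, the constant `c` in the
definition of `q`, the design procedure, and a rule that breaks ties in the final `argmax`. -/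
structure Input (d : ℕ) where
  arms : Finset (Vec d)
  T : ℕ
  B : ℕ
  c : ℝ
  design : Finset (Vec d) → ℝ → ℝ → List (Vec d)
  tie : Finset (Vec d) → Vec d

/-- `q = (T / c) ^ (1 / B)`. -/
def Input.q (I : Input d) : ℝ := ((I.T : ℝ) / I.c) ^ (1 / (I.B : ℝ))

/-- `δ = 1 / (K T²)`. -/
def Input.delta (I : Input d) : ℝ := 1 / ((I.arms.card : ℝ) * (I.T : ℝ) ^ 2)

/-- `ε_i = √(d log(K T²) / q^i)`. -/
def Input.eps (I : Input d) (i : ℕ) : ℝ :=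
  Real.sqrt (d * Real.log ((I.arms.card : ℝ) * (I.T : ℝ) ^ 2) / I.q ^ i)

open scoped Classical in
/-- Remove every `a ∈ A` with `⟨a, θ⟩ < max_{b ∈ A} ⟨b, θ⟩ - 2 ε`. -/
def eliminate (A : Finset (Vec d)) (θ : Vec d) (ε : ℝ) : Finset (Vec d) :=
  A.filter fun a => ¬ ∃ b ∈ A, (inner ℝ a θ : ℝ) < inner ℝ b θ - 2 * ε

open scoped Classical in
/-- The set of maximizers of `⟨a, θ⟩` over `a ∈ A`. -/
def maximizers (A : Finset (Vec d)) (θ : Vec d) : Finset (Vec d) :=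
  A.filter fun a => ∀ b ∈ A, (inner ℝ b θ : ℝ) ≤ inner ℝ a θ

/-- The batches played from batch `i` on, if at most `m` batches may precede the last one, `t`
rounds have been played, `A` is the set of active arms and `θ` the last estimate. The rounds are
numbered from `0`, and `r s a` is the reward for playing `a` in round `s`. -/
def Input.batchesFrom (I : Input d) (r : ℕ → Vec d → ℝ) :
    (m i t : ℕ) → Finset (Vec d) → Vec d → List (List (Vec d))
  | 0, _, t, A, θ => [List.replicate (I.T - t) (I.tie (maximizers A θ))]
  | m + 1, i, t, A, θ =>
    let S := I.design A (I.eps i) I.delta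
    if I.T - t < S.length then [List.replicate (I.T - t) (I.tie (maximizers A θ))]
    else
      let θ' := leastSquares S fun j => r (t + j) (S.get j)
      S :: I.batchesFrom r m (i + 1) (t + S.length) (eliminate A θ' (I.eps i)) θ'

/-- The list of all batches played by the algorithm when the rewards are given by `r`. -/
def Input.batches (I : Input d) (r : ℕ → Vec d → ℝ) : List (List (Vec d)) :=
  I.batchesFrom r (I.B - 1) 1 0 I.arms 0

/-- The rewards `⟨a, θ⟩ + η_t` of the stochastic linear bandit with parameter `θ`. -/
def rewards {Ω : Type*} (θ : Vec d) (η : ℕ → Ω → ℝ) (ω : Ω) (t : ℕ) (a : Vec d) : ℝ :=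
  inner ℝ a θ + η t ω

/-- The list `a_1, …, a_T` of all arms played by the algorithm. -/
def Input.played {Ω : Type*} (I : Input d) (θ : Vec d) (η : ℕ → Ω → ℝ) (ω : Ω) : List (Vec d) :=
  (I.batches (rewards θ η ω)).flatten

/-- `∑_t ⟨a_t, θ⟩`. -/
def Input.gain {Ω : Type*} (I : Input d) (θ : Vec d) (η : ℕ → Ω → ℝ) (ω : Ω) : ℝ :=
  ((I.played θ η ω).map fun a => (inner ℝ a θ : ℝ)).sum

/-- The expected regret `T sup_a ⟨a, θ⟩ - E ∑_t ⟨a_t, θ⟩`. -/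
def Input.regret {Ω : Type*} [MeasurableSpace Ω] (I : Input d) (P : Measure Ω) (θ : Vec d)
    (η : ℕ → Ω → ℝ) : ℝ :=
  I.T * (⨆ a : I.arms, (inner ℝ (a : Vec d) θ : ℝ)) - ∫ ω, I.gain θ η ω ∂P

/-- The algorithm plays exactly `T` rounds, in at most `B` batches, uses only the given arms, its
total mean reward is integrable, and its expected regret is at most `R`. -/
structure Input.Achieves {Ω : Type*} [MeasurableSpace Ω] (I : Input d) (P : Measure Ω)
    (θ : Vec d) (η : ℕ → Ω → ℝ) (B : ℕ) (R : ℝ) : Prop where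
  batches_le : ∀ ω, (I.batches (rewards θ η ω)).length ≤ B
  rounds : ∀ ω, (I.played θ η ω).length = I.T
  mem_arms : ∀ ω, ∀ a ∈ I.played θ η ω, a ∈ I.arms
  integrable : Integrable (I.gain θ η) P
  regret_le : I.regret P θ η ≤ R

end BatchedLinearBandit

end

open BatchedLinearBandit

/-!
The construction of designs rests on one observation: a sequence `S` of `n` arms that maximizes the
determinant of `∑ s sᵀ` on the span of `A` is already approximately G-optimal. Replacing a member
`s` by `a ∈ A` multiplies the determinant by `(1 + h_a) (1 - h_s) + (sᵀ G⁻¹ a)²`, where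
`h_a = aᵀ G⁻¹ a` (`det_exchange`), and this factor is at most `1`. Summing over `s ∈ S`, with
`∑ h_s = ρ` (`sum_leverage`) and `∑ (sᵀ G⁻¹ a)² = h_a`, gives `(n - ρ + 1) h_a ≤ ρ`
(`exists_leverage_le`). So `n ≥ 2 ρ` arms make `n h_a ≤ 2 ρ`, without any rounding of a continuous
design. The least-squares error in the direction `a` is a subgaussian variable with variance proxy
`h_a`, hence `n ≥ 8 ρ log (1 / δ) / ε²` arms give the accuracy (`exists_design`).

For the regret, call a run good if the estimate of every batch is accurate for all active arms.
Then the best arm is never removed and after batch `i` all active arms have gap at most `4 ε_i`.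
Batch `i` has at most `C max {d, q ^ i}` rounds. The batches with at most `C d` rounds have at most
`min {T, B C d} ≤ √(T B C d)` rounds altogether, and each of these costs at most `2`; the others
cost `C q ^ i · 4 ε_{i-1}`, which is of order `√(d log (K T²)) q ^ ((i + 1) / 2)`, or `2 C q` if
`i = 1`. The last batch costs `4 T ε_{B-1}`, and a batch that does not fit into the remaining rounds
leaves fewer rounds than its own length, so that these obey the bound of the regular batch
(`Input.regret_flatten_le`). If `B ≤ κ (1 + log T)` and `T` is large, then `q` is at least a constant
larger than `1`, the costs for `2 ≤ i < B` form a geometric sum dominated by its last term, and `q ^ B = T / c` evaluates the bound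
(`Input.IsValid.cost_le`); small `T` are absorbed by the constant.

A run fails to be good with probability at most `B K δ = B / T²` (`prob_not_good_le`), by induction
on the number of batches from the last one backwards: the set of arms that survive a batch is a
function of the noises up to this batch with finitely many values, so that it is independent of what
happens afterwards with any fixed set of arms.
-/

namespace BatchedLinearBandit

variable {d : ℕ}

/-! ### The information matrix and its inverse -/

theorem gram_ofFn {n : ℕ} (f : Fin n → Vec d) :
    gram (List.ofFn f) = ∑ j, (innerSL ℝ (f j)).smulRight (f j) := by
  have h := Fin.sum_univ_fun_getElem (List.ofFn f) fun a => (innerSL ℝ a).smulRight a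
  rw [List.map_ofFn, List.sum_ofFn] at h
  exact h

theorem spanOf_ofFn {n : ℕ} (f : Fin n → Vec d) :
    spanOf (List.ofFn f) = Submodule.span ℝ (Set.range f) := by
  simp [spanOf, List.mem_ofFn', Set.range]

theorem get_mem_spanOf (S : List (Vec d)) (j : Fin S.length) : S.get j ∈ spanOf S :=
  Submodule.subset_span (List.get_mem S j)

theorem gram_mem_spanOf (S : List (Vec d)) (x : Vec d) : gram S x ∈ spanOf S := by
  rw [gram_apply]
  exact Submodule.sum_mem _ fun j _ => Submodule.smul_mem _ _ (get_mem_spanOf S j)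

theorem inner_gram (S : List (Vec d)) (x y : Vec d) :
    inner ℝ (gram S x) y = ∑ j, inner ℝ (S.get j) x * inner ℝ (S.get j) y := by
  rw [gram_apply, sum_inner]
  exact Finset.sum_congr rfl fun j _ => real_inner_smul_left _ _ _

theorem inner_gram_comm (S : List (Vec d)) (x y : Vec d) :
    (inner ℝ (gram S x) y : ℝ) = inner ℝ x (gram S y) := by
  rw [real_inner_comm (gram S y) x, inner_gram, inner_gram]
  exact Finset.sum_congr rfl fun j _ => mul_comm _ _

theorem gram_add_proj_gramInv (S : List (Vec d)) (x : Vec d) :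
    gram S (gramInv S x) + (spanOf S)ᗮ.starProjection (gramInv S x) = x := by
  have h := congrArg (fun L => L x) (Ring.mul_inverse_cancel _ (isUnit_gram_add S))
  simpa [gramInv] using h

theorem gramInv_gram_add_proj (S : List (Vec d)) (x : Vec d) :
    gramInv S (gram S x + (spanOf S)ᗮ.starProjection x) = x := by
  have h := congrArg (fun L => L x) (Ring.inverse_mul_cancel _ (isUnit_gram_add S))
  simpa [gramInv] using h

theorem inner_gramInv_comm (S : List (Vec d)) (x y : Vec d) :
    (inner ℝ (gramInv S x) y : ℝ) = inner ℝ x (gramInv S y) := by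
  conv_lhs => rw [← gram_add_proj_gramInv S y]
  conv_rhs => rw [← gram_add_proj_gramInv S x]
  rw [inner_add_left, inner_add_right, inner_gram_comm,
    Submodule.inner_starProjection_left_eq_right]

theorem gramInv_mem_spanOf {S : List (Vec d)} {a : Vec d} (ha : a ∈ spanOf S) :
    gramInv S a ∈ spanOf S := by
  have h : (spanOf S)ᗮ.starProjection (gramInv S a) ∈ spanOf S := by
    rw [eq_sub_of_add_eq' (gram_add_proj_gramInv S a)]
    exact Submodule.sub_mem _ ha (gram_mem_spanOf S _)
  have h0 : (spanOf S)ᗮ.starProjection (gramInv S a) = 0 :=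
    inner_self_eq_zero (𝕜 := ℝ).1
      (((spanOf S).mem_orthogonal _).1 ((spanOf S)ᗮ.starProjection_apply_mem _) _ h)
  rw [Submodule.starProjection_apply_eq_zero_iff, Submodule.orthogonal_orthogonal] at h0
  exact h0

theorem proj_orthogonal_eq_zero {W : Submodule ℝ (Vec d)} {x : Vec d} (hx : x ∈ W) :
    Wᗮ.starProjection x = 0 := by
  rwa [Submodule.starProjection_apply_eq_zero_iff, Submodule.orthogonal_orthogonal]

theorem gram_gramInv {S : List (Vec d)} {a : Vec d} (ha : a ∈ spanOf S) :
    gram S (gramInv S a) = a := by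
  have h := gram_add_proj_gramInv S a
  rwa [proj_orthogonal_eq_zero (gramInv_mem_spanOf ha), add_zero] at h

theorem inner_gramInv_eq_sum_sq {S : List (Vec d)} {a : Vec d} (ha : a ∈ spanOf S) :
    (inner ℝ a (gramInv S a) : ℝ) = ∑ j, (inner ℝ (S.get j) (gramInv S a) : ℝ) ^ 2 := by
  have h := inner_gram S (gramInv S a) (gramInv S a)
  rw [gram_gramInv ha] at h
  rw [h]
  exact Finset.sum_congr rfl fun j _ => (sq _).symm

/-- On the span of the played arms the least-squares estimate is unbiased, and its error is a
linear combination of the noises whose squared coefficients sum up to `aᵀ (∑ s sᵀ)⁻¹ a`. -/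
theorem inner_leastSquares_sub {S : List (Vec d)} {a : Vec d} (ha : a ∈ spanOf S) (θ : Vec d)
    (x : Fin S.length → ℝ) :
    (inner ℝ a (leastSquares S (fun j => inner ℝ (S.get j) θ + x j) - θ) : ℝ)
      = ∑ j, inner ℝ (S.get j) (gramInv S a) * x j := by
  have h : (inner ℝ a θ : ℝ) = ∑ j, inner ℝ (S.get j) (gramInv S a) * inner ℝ (S.get j) θ := by
    rw [← inner_gram, gram_gramInv ha]
  rw [inner_sub_right, leastSquares, ← inner_gramInv_comm, inner_sum, h, ← Finset.sum_sub_distrib]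
  refine Finset.sum_congr rfl fun j _ => ?_
  rw [real_inner_smul_right, real_inner_comm (S.get j) (gramInv S a)]
  ring

/-- The leverages sum up to the dimension of the span: they are the diagonal of a projection. -/
theorem sum_leverage (S : List (Vec d)) :
    ∑ j, (inner ℝ (S.get j) (gramInv S (S.get j)) : ℝ) = Module.finrank ℝ (spanOf S) := by
  have hp : LinearMap.IsProj (spanOf S)
      ((gramInv S : Vec d →ₗ[ℝ] Vec d) ∘ₗ (gram S : Vec d →ₗ[ℝ] Vec d)) := by
    refine ⟨fun x => gramInv_mem_spanOf (gram_mem_spanOf S x), fun x hx => ?_⟩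
    have h := gramInv_gram_add_proj S x
    rwa [proj_orthogonal_eq_zero hx, add_zero] at h
  have hs : (gramInv S : Vec d →ₗ[ℝ] Vec d) ∘ₗ (gram S : Vec d →ₗ[ℝ] Vec d)
      = ∑ j, (innerₛₗ ℝ (S.get j)).smulRight (gramInv S (S.get j)) := by
    ext1 x
    simp [gram_apply, map_sum]
  rw [← hp.trace, hs, map_sum]
  exact Finset.sum_congr rfl fun j _ => by rw [LinearMap.trace_smulRight]; rfl

/-! ### Determinants and exchange steps -/

/-- Matrix determinant lemma, for a rank-one update in the direction of an image `N y`. -/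
theorem det_add_smulRight (N : Vec d →ₗ[ℝ] Vec d) (φ : Module.Dual ℝ (Vec d)) (y : Vec d) :
    LinearMap.det (N + φ.smulRight (N y)) = LinearMap.det N * (1 + φ y) := by
  have : N + φ.smulRight (N y) = N ∘ₗ LinearMap.transvection φ y := by
    ext1 x
    simp [LinearMap.transvection]
  rw [this, LinearMap.det_comp, LinearMap.transvection.det]

/-- The determinant after replacing `s` by `a` in a sequence of vectors. Here `u` and `v` stand
for `N⁻¹ a` and `N⁻¹ s`. -/
theorem det_exchange (N : Vec d →ₗ[ℝ] Vec d) {a s u v : Vec d} (hu : N u = a) (hv : N v = s)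
    (hN : (inner ℝ a v : ℝ) = inner ℝ s u) (ha : 0 ≤ (inner ℝ a u : ℝ)) :
    LinearMap.det (N + (innerₛₗ ℝ a).smulRight a - (innerₛₗ ℝ s).smulRight s)
      = LinearMap.det N * ((1 + inner ℝ a u) * (1 - inner ℝ s v) + (inner ℝ s u : ℝ) ^ 2) := by
  have h1 : (1 + inner ℝ a u : ℝ) ≠ 0 := by positivity
  have e1 := det_add_smulRight N (innerₛₗ ℝ a) u
  rw [hu] at e1
  have hy : (N + (innerₛₗ ℝ a).smulRight a) (v - (inner ℝ a v / (1 + inner ℝ a u) : ℝ) • u) = s := by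
    simp only [LinearMap.add_apply, LinearMap.smulRight_apply, map_sub, map_smul, hu, hv,
      innerₛₗ_apply_apply]
    have h : (inner ℝ a v / (1 + inner ℝ a u) * (1 + inner ℝ a u) : ℝ) = inner ℝ a v :=
      div_mul_cancel₀ _ h1
    rw [show a + (inner ℝ a u : ℝ) • a = (1 + inner ℝ a u : ℝ) • a by module, smul_smul, h,
      add_sub_cancel_right]
  have e2 := det_add_smulRight (N + (innerₛₗ ℝ a).smulRight a) (-(innerₛₗ ℝ s))
    (v - (inner ℝ a v / (1 + inner ℝ a u) : ℝ) • u)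
  rw [hy, e1] at e2
  have e3 : (-(innerₛₗ ℝ s) : Module.Dual ℝ (Vec d)).smulRight s
      = -((innerₛₗ ℝ s).smulRight s) := by
    ext1 x; simp
  rw [e3, ← sub_eq_add_neg] at e2
  rw [e2]
  simp only [LinearMap.neg_apply, innerₛₗ_apply_apply, inner_sub_right, real_inner_smul_right, hN]
  field_simp
  ring

/-- `∑ s sᵀ` over the sequence `f`, made invertible by the projection onto `Wᗮ`. -/
noncomputable def infoOp (W : Submodule ℝ (Vec d)) {n : ℕ} (f : Fin n → Vec d) :
    Vec d →ₗ[ℝ] Vec d :=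
  ∑ j, (innerₛₗ ℝ (f j)).smulRight (f j) + (Wᗮ.starProjection : Vec d →ₗ[ℝ] Vec d)

theorem coe_gram_ofFn_add (W : Submodule ℝ (Vec d)) {n : ℕ} (f : Fin n → Vec d) :
    ((gram (List.ofFn f) + Wᗮ.starProjection : Vec d →L[ℝ] Vec d) : Vec d →ₗ[ℝ] Vec d)
      = infoOp W f := by
  rw [gram_ofFn, infoOp]
  ext1 x
  simp

theorem infoOp_update (W : Submodule ℝ (Vec d)) {n : ℕ} (f : Fin n → Vec d) (j : Fin n)
    (a : Vec d) :
    infoOp W (Function.update f j a)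
      = infoOp W f + (innerₛₗ ℝ a).smulRight a - (innerₛₗ ℝ (f j)).smulRight (f j) := by
  have h : (fun k => (innerₛₗ ℝ (Function.update f j a k)).smulRight (Function.update f j a k))
      = Function.update (fun k => (innerₛₗ ℝ (f k)).smulRight (f k)) j
        ((innerₛₗ ℝ a).smulRight a) := by
    ext1 k
    by_cases hk : k = j
    · subst hk; simp
    · simp [hk]
  rw [infoOp, h, Finset.sum_update_of_mem (Finset.mem_univ j), infoOp,
    ← Finset.add_sum_erase _ _ (Finset.mem_univ j), Finset.sdiff_singleton_eq_erase]
  abel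

/-- A sequence of vectors of `W` with nonzero determinant spans `W`. -/
theorem span_eq_of_det_infoOp_ne_zero {W : Submodule ℝ (Vec d)} {n : ℕ} {f : Fin n → Vec d}
    (hf : ∀ j, f j ∈ W) (h : LinearMap.det (infoOp W f) ≠ 0) : spanOf (List.ofFn f) = W := by
  have hle : spanOf (List.ofFn f) ≤ W := by
    rw [spanOf_ofFn, Submodule.span_le]
    rintro _ ⟨j, rfl⟩
    exact hf j
  by_contra hne
  obtain ⟨w, hwW, hw⟩ := SetLike.exists_of_lt (lt_of_le_of_ne hle hne)
  -- The part of `w` orthogonal to the sequence lies in `W`, hence in the kernel of `infoOp W f`.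
  set V := spanOf (List.ofFn f)
  have hz : infoOp W f (w - V.starProjection w) = 0 := by
    have hW : w - V.starProjection w ∈ W :=
      W.sub_mem hwW (hle (V.starProjection_apply_mem w))
    rw [infoOp, LinearMap.add_apply, ContinuousLinearMap.coe_coe, proj_orthogonal_eq_zero hW,
      add_zero, LinearMap.sum_apply]
    refine Finset.sum_eq_zero fun j _ => ?_
    have : (inner ℝ (f j) (w - V.starProjection w) : ℝ) = 0 := by
      have hm : f j ∈ V := by
        rw [show V = _ from spanOf_ofFn f]; exact Submodule.subset_span ⟨j, rfl⟩
      exact (V.mem_orthogonal _).1 (V.sub_starProjection_mem_orthogonal w) _ hm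
    simp [this]
  have hker : LinearMap.ker (infoOp W f) = ⊥ :=
    LinearMap.isUnit_iff_ker_eq_bot _ |>.1 ((LinearMap.isUnit_iff_isUnit_det _).2 h.isUnit)
  have h0 : w - V.starProjection w = 0 := LinearMap.ker_eq_bot'.1 hker _ hz
  exact hw (by rw [sub_eq_zero.1 h0]; exact V.starProjection_apply_mem w)

theorem det_infoOp_ne_zero_of_span_eq {W : Submodule ℝ (Vec d)} {n : ℕ} {f : Fin n → Vec d}
    (h : spanOf (List.ofFn f) = W) : LinearMap.det (infoOp W f) ≠ 0 := by
  have hu := isUnit_gram_add (List.ofFn f)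
  rw [ContinuousLinearMap.isUnit_iff_isUnit_toLinearMap, h, coe_gram_ofFn_add] at hu
  exact ((LinearMap.isUnit_iff_isUnit_det _).1 hu).ne_zero

/-- Elements of `A`, at least as many as the rank of `A`, can be chosen so as to span the space
that `A` spans. -/
theorem exists_spanning (A : Finset (Vec d)) (hA : A.Nonempty) {n : ℕ} (hn : rk A ≤ n) :
    ∃ f : Fin n → A, spanOf (List.ofFn fun j => (f j : Vec d))
      = Submodule.span ℝ (A : Set (Vec d)) := by
  obtain ⟨g, hg, hspan, -⟩ := Submodule.exists_fun_fin_finrank_span_eq ℝ (A : Set (Vec d))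
  obtain ⟨a₀, ha₀⟩ := hA
  -- A basis among the elements of `A`, padded with copies of `a₀`.
  refine ⟨fun j => if h : (j : ℕ) < rk A then ⟨g ⟨j, h⟩, hg _⟩ else ⟨a₀, ha₀⟩, ?_⟩
  rw [spanOf_ofFn]
  refine le_antisymm (Submodule.span_mono ?_) ?_
  · rintro _ ⟨j, rfl⟩
    exact Subtype.coe_prop _
  · refine hspan.ge.trans (Submodule.span_mono ?_)
    rintro _ ⟨j, rfl⟩
    refine ⟨⟨j, j.2.trans_le hn⟩, ?_⟩
    have : (j : ℕ) < rk A := j.2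
    simp [this]

/-- A sequence of `n` elements of `A` that maximizes the determinant has leverages at most
`ρ / (n - ρ + 1)`. For every `a`, exchanging one of its members for `a` does not increase the
determinant; summing these `n` inequalities gives the bound, as the leverages of the members sum
up to `ρ`. -/
theorem exists_leverage_le (A : Finset (Vec d)) (hA : A.Nonempty) {n : ℕ} (hn : rk A ≤ n) :
    ∃ S : List (Vec d), S.length = n ∧ (∀ a ∈ S, a ∈ A) ∧
      spanOf S = Submodule.span ℝ (A : Set (Vec d)) ∧
      ∀ a ∈ A, ((n : ℝ) - rk A + 1) * inner ℝ a (gramInv S a) ≤ rk A := by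
  set W := Submodule.span ℝ (A : Set (Vec d)) with hW
  obtain ⟨f₀, hf₀⟩ := exists_spanning A hA hn
  have : Nonempty (Fin n → A) := ⟨f₀⟩
  obtain ⟨f, hf⟩ := Finite.exists_max
    fun f : Fin n → A => |LinearMap.det (infoOp W fun j => (f j : Vec d))|
  have hdet : LinearMap.det (infoOp W fun j => (f j : Vec d)) ≠ 0 := by
    have := hf f₀
    have h2 := abs_pos.2 (det_infoOp_ne_zero_of_span_eq hf₀)
    exact abs_pos.1 (h2.trans_le this)
  have hAW : ∀ a ∈ A, a ∈ W := fun a ha => Submodule.subset_span ha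
  have hspan : spanOf (List.ofFn fun j => (f j : Vec d)) = W :=
    span_eq_of_det_infoOp_ne_zero (fun j => hAW _ (f j).2) hdet
  set S := List.ofFn fun j => (f j : Vec d) with hS
  have hlen : S.length = n := List.length_ofFn
  refine ⟨S, hlen, ?_, hspan, fun a ha => ?_⟩
  · intro a ha
    obtain ⟨j, rfl⟩ := (List.mem_ofFn' _ _).1 ha
    exact (f j).2
  have hinv : ∀ x, infoOp W (fun j => (f j : Vec d)) (gramInv S x) = x := by
    intro x
    have := gram_add_proj_gramInv S x
    rw [hspan] at this
    rw [← coe_gram_ofFn_add]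
    exact this
  have haS : a ∈ spanOf S := hspan ▸ hAW a ha
  have hpos : 0 ≤ (inner ℝ a (gramInv S a) : ℝ) := by
    rw [inner_gramInv_eq_sum_sq haS]
    positivity
  have hex : ∀ s ∈ S, (1 + inner ℝ a (gramInv S a)) * (1 - inner ℝ s (gramInv S s))
      + (inner ℝ s (gramInv S a) : ℝ) ^ 2 ≤ 1 := by
    intro s hs
    obtain ⟨j, rfl⟩ := (List.mem_ofFn' _ _).1 hs
    have h1 := hf (Function.update f j ⟨a, ha⟩)
    have h2 : (fun k => ((Function.update f j ⟨a, ha⟩ k : A) : Vec d))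
        = Function.update (fun k => (f k : Vec d)) j a := by
      ext1 k
      by_cases hk : k = j
      · subst hk; simp
      · simp [hk]
    rw [h2, infoOp_update, det_exchange _ (hinv a) (hinv _) _ hpos, abs_mul] at h1
    · exact (le_abs_self _).trans
        (le_of_mul_le_mul_left (h1.trans_eq (mul_one _).symm) (abs_pos.2 hdet))
    · rw [← inner_gramInv_comm, real_inner_comm]
  have hsum := Finset.sum_le_sum fun (j : Fin S.length) (_ : j ∈ Finset.univ) =>
    hex _ (List.get_mem S j)
  rw [Finset.sum_add_distrib, ← Finset.mul_sum, Finset.sum_sub_distrib, sum_leverage,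
    ← inner_gramInv_eq_sum_sq haS, hspan] at hsum
  simp only [Finset.sum_const, Finset.card_univ, Fintype.card_fin, hlen, nsmul_eq_mul,
    mul_one] at hsum
  change (1 + _) * ((n : ℝ) - (rk A : ℕ)) + _ ≤ (n : ℝ) at hsum
  linarith

/-! ### Accuracy of the least-squares estimate and existence of design rules -/

theorem hasSubgaussianMGF_mono {Ω : Type*} [MeasurableSpace Ω] {μ : Measure Ω} {X : Ω → ℝ}
    {v w : NNReal} (h : HasSubgaussianMGF X v μ) (hvw : v ≤ w) : HasSubgaussianMGF X w μ where
  integrable_exp_mul := h.integrable_exp_mul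
  mgf_le t := (h.mgf_le t).trans <| Real.exp_le_exp.2 <| by
    have : (v : ℝ) ≤ w := hvw
    gcongr

/-- Two-sided tail bound for a linear combination of independent noises with squared coefficients
of sum at most `w`. -/
theorem noise_tail {n : ℕ} (ν : Fin n → Measure ℝ) (hν : ∀ j, IsNoiseLaw (ν j)) (b : Fin n → ℝ)
    {w ε δ : ℝ} (hε : 0 < ε) (hδ : 0 < δ) (hw : 0 < w) (hb : ∑ j, b j ^ 2 ≤ w)
    (hwε : 2 * w * Real.log (2 / δ) ≤ ε ^ 2) :
    1 - δ ≤ (Measure.pi ν).real {x | |∑ j, b j * x j| ≤ ε} := by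
  have := fun j => (hν j).1
  have hind : iIndepFun (fun (j : Fin n) (x : Fin n → ℝ) => b j * x j) (Measure.pi ν) :=
    iIndepFun_pi (X := fun j y => b j * y) fun j => by fun_prop
  have hsub : ∀ j ∈ Finset.univ, HasSubgaussianMGF (fun x : Fin n → ℝ => b j * x j)
      (b j ^ 2).toNNReal (Measure.pi ν) := by
    intro j _
    have h1 : HasSubgaussianMGF (fun x : Fin n → ℝ => x j) 1 (Measure.pi ν) := by
      refine HasSubgaussianMGF.of_map (X := fun y : ℝ => y) (Y := fun x : Fin n → ℝ => x j)
        (measurable_pi_apply j).aemeasurable ?_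
      have h2 : (Measure.pi ν).map (fun x : Fin n → ℝ => x j) = ν j :=
        (measurePreserving_eval ν j).map_eq
      rw [h2]
      exact (hν j).2.2
    refine hasSubgaussianMGF_mono (h1.const_mul (b j)) (NNReal.coe_le_coe.1 ?_)
    rw [Real.coe_toNNReal _ (sq_nonneg _)]
    exact (mul_one (b j ^ 2)).le
  have hS := hasSubgaussianMGF_mono (w := w.toNNReal)
    (HasSubgaussianMGF.sum_of_iIndepFun hind hsub) (by
      rw [← NNReal.coe_le_coe, NNReal.coe_sum, Real.coe_toNNReal _ hw.le]
      simpa only [Real.coe_toNNReal _ (sq_nonneg _)] using hb)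
  have hwc : (w.toNNReal : ℝ) = w := Real.coe_toNNReal _ hw.le
  have hexp : Real.exp (-ε ^ 2 / (2 * w)) ≤ δ / 2 := by
    rw [← Real.le_log_iff_exp_le (by positivity), ← inv_div 2 δ, Real.log_inv, neg_div, neg_le_neg_iff,
      le_div_iff₀ (by positivity)]
    linarith
  rw [← hwc] at hexp
  have h1 := (hS.measure_ge_le hε.le).trans hexp
  have h2 := (hS.neg.measure_ge_le hε.le).trans hexp
  have hcompl : {x : Fin n → ℝ | |∑ j, b j * x j| ≤ ε}ᶜ ⊆
      {x | ε ≤ ∑ j, b j * x j} ∪ {x | ε ≤ (-fun x : Fin n → ℝ => ∑ j, b j * x j) x} := by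
    intro x hx
    simp only [Set.mem_compl_iff, Set.mem_ofPred_eq, not_le] at hx
    rcases lt_abs.1 hx with h | h
    · exact Or.inl h.le
    · exact Or.inr h.le
  have h3 := (measureReal_mono (μ := Measure.pi ν) hcompl).trans (measureReal_union_le _ _)
  have hmeas : MeasurableSet {x : Fin n → ℝ | |∑ j, b j * x j| ≤ ε} :=
    measurableSet_le (by fun_prop) measurable_const
  rw [probReal_compl_eq_one_sub hmeas] at h3
  linarith

theorem isAccurate_of_leverage_le {A : Finset (Vec d)} {S : List (Vec d)} {ε δ : ℝ}
    (hS : spanOf S = Submodule.span ℝ (A : Set (Vec d))) (hε : 0 < ε) (hδ : 0 < δ) (hδ2 : δ ≤ 1 / 2)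
    (h : ∀ a ∈ A, 4 * Real.log (1 / δ) * inner ℝ a (gramInv S a) ≤ ε ^ 2) :
    IsAccurate A ε δ S := by
  intro θ _ ν hν a ha
  have haS : a ∈ spanOf S := hS ▸ Submodule.subset_span ha
  simp_rw [inner_leastSquares_sub haS]
  have hlog : Real.log (1 / δ) ≥ Real.log 2 :=
    Real.log_le_log two_pos (by rw [le_div_iff₀ hδ]; linarith)
  have hlog2 : 0 < Real.log 2 := Real.log_pos one_lt_two
  have hlog' : Real.log (2 / δ) ≤ 2 * Real.log (1 / δ) := by
    rw [show 2 / δ = 2 * (1 / δ) by ring, Real.log_mul (by norm_num) (by positivity)]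
    linarith
  have hL : 0 < Real.log (1 / δ) := by linarith
  refine noise_tail ν hν _ hε hδ (w := ε ^ 2 / (4 * Real.log (1 / δ))) (by positivity) ?_ ?_
  · rw [← inner_gramInv_eq_sum_sq haS, le_div_iff₀ (by positivity)]
    linarith [h a ha]
  · calc 2 * (ε ^ 2 / (4 * Real.log (1 / δ))) * Real.log (2 / δ)
        ≤ 2 * (ε ^ 2 / (4 * Real.log (1 / δ))) * (2 * Real.log (1 / δ)) := by gcongr
      _ = ε ^ 2 := by field_simp; ring

theorem rk_le (A : Finset (Vec d)) : rk A ≤ d :=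
  (Submodule.finrank_le _).trans_eq (by simp)

/-- Twice as many arms as the rank suffice for G-optimality up to a factor `2`, and eight times
`ρ log (1 / δ) / ε ^ 2` for accuracy. -/
theorem exists_design (A : Finset (Vec d)) (hA : A.Nonempty) {ε δ : ℝ} (hε : 0 < ε) (hδ : 0 < δ)
    (hδ2 : δ ≤ 1 / 2) : ∃ S, IsDesign 8 9 A ε δ S ∧ IsApproxGOptimal A S := by
  set L := Real.log (1 / δ) / ε ^ 2 with hLdef
  have hL : 0 ≤ L := by
    have : 0 ≤ Real.log (1 / δ) := Real.log_nonneg (by rw [le_div_iff₀ hδ]; linarith)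
    positivity
  have hρ : (0 : ℝ) ≤ rk A := Nat.cast_nonneg _
  set n := ⌈max (2 * rk A : ℝ) (8 * (rk A * L))⌉₊ with hn
  have hle := Nat.le_ceil (max (2 * rk A : ℝ) (8 * (rk A * L)))
  rw [← hn, max_le_iff] at hle
  obtain ⟨hn1, hn2⟩ := hle
  have hnρ : rk A ≤ n := by
    have : (rk A : ℝ) ≤ n := by linarith
    exact_mod_cast this
  obtain ⟨S, hlen, hmem, hspan, hlev⟩ := exists_leverage_le A hA hnρ
  have hnonneg : ∀ a ∈ A, 0 ≤ (inner ℝ a (gramInv S a) : ℝ) := by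
    intro a ha
    rw [inner_gramInv_eq_sum_sq (hspan ▸ Submodule.subset_span ha)]
    positivity
  have hG : ∀ a ∈ A, (n : ℝ) * inner ℝ a (gramInv S a) ≤ 2 * rk A := by
    intro a ha
    nlinarith [hlev a ha, hnonneg a ha]
  refine ⟨S, ⟨hmem, hspan, ?_, ?_, ?_⟩, hspan, ?_⟩
  · refine isAccurate_of_leverage_le hspan hε hδ hδ2 fun a ha => ?_
    have hLε : Real.log (1 / δ) = L * ε ^ 2 := by rw [hLdef]; field_simp
    rw [hLε]
    have h4 : 4 * L * inner ℝ a (gramInv S a) ≤ 1 := by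
      rcases Nat.eq_zero_or_pos (rk A) with h0 | h0
      · have h1 := hlev a ha
        rw [h0] at h1
        have hn0 : (0 : ℝ) ≤ n := Nat.cast_nonneg _
        have h2 : (inner ℝ a (gramInv S a) : ℝ) = 0 := by
          have := hnonneg a ha
          push_cast at h1
          nlinarith
        rw [h2]; norm_num
      · have h0' : (0 : ℝ) < rk A := Nat.cast_pos.2 h0
        have h1 := mul_le_mul_of_nonneg_right hn2 (hnonneg a ha)
        have h2 := hG a ha
        refine le_of_mul_le_mul_left (a := 2 * (rk A : ℝ)) ?_ (by positivity)
        linarith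
    nlinarith [sq_nonneg ε]
  · rw [hlen]; exact hn2
  · rw [hlen]
    -- For `A = {0}` the design is empty; otherwise rounding up costs at most `1 ≤ rk A`.
    rcases Nat.eq_zero_or_pos (rk A) with h0 | h0
    · have : n = 0 := by rw [hn, h0]; simp
      rw [this]
      have := le_max_left (rk A : ℝ) (d * L)
      push_cast
      linarith
    · have h1 : (1 : ℝ) ≤ rk A := by exact_mod_cast h0
      have h2 : (n : ℝ) < max (2 * rk A : ℝ) (8 * (rk A * L)) + 1 :=
        Nat.ceil_lt_add_one (le_max_of_le_left (by positivity))
      have h3 := le_max_left (rk A : ℝ) (d * L)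
      have h4 := le_max_right (rk A : ℝ) (d * L)
      have h5 : (rk A : ℝ) * L ≤ d * L := by
        have : (rk A : ℝ) ≤ d := by exact_mod_cast rk_le A
        gcongr
      have h6 : max (2 * rk A : ℝ) (8 * (rk A * L)) ≤ 8 * max (rk A : ℝ) (d * L) :=
        max_le (by linarith) (by linarith)
      linarith
  · rw [hlen]; exact hG

theorem exists_designRule (d : ℕ) :
    ∃ D : Finset (Vec d) → ℝ → ℝ → List (Vec d), IsDesignRule 8 9 D ∧
      ∀ A : Finset (Vec d), A.Nonempty → ∀ ε δ : ℝ, 0 < ε → 0 < δ → δ ≤ 1 / 2 →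
        IsApproxGOptimal A (D A ε δ) := by
  have h : ∀ (A : Finset (Vec d)) (ε δ : ℝ), ∃ S : List (Vec d),
      A.Nonempty → 0 < ε → 0 < δ → δ ≤ 1 / 2 → IsDesign 8 9 A ε δ S ∧ IsApproxGOptimal A S := by
    intro A ε δ
    by_cases hc : A.Nonempty ∧ 0 < ε ∧ 0 < δ ∧ δ ≤ 1 / 2
    · obtain ⟨S, hS⟩ := exists_design A hc.1 hc.2.1 hc.2.2.1 hc.2.2.2
      exact ⟨S, fun _ _ _ _ => hS⟩
    · exact ⟨[], fun h1 h2 h3 h4 => (hc ⟨h1, h2, h3, h4⟩).elim⟩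
  choose D hD using h
  exact ⟨D, fun A hA ε δ h1 h2 h3 => (hD A ε δ hA h1 h2 h3).1,
    fun A hA ε δ h1 h2 h3 => (hD A ε δ hA h1 h2 h3).2⟩

/-! ### Parameters of the algorithm -/

/-- The standing assumptions on the input of the algorithm, when its design procedure is a
`(c, C)`-design rule for the constant `c` that enters `q`. -/
structure Input.IsValid (I : Input d) (C : ℝ) : Prop where
  one_le_d : 1 ≤ d
  one_le_B : 1 ≤ I.B
  two_le : 2 ≤ I.arms.card * I.T
  norm_le : ∀ a ∈ I.arms, ‖a‖ ≤ 1
  c_pos : 0 < I.c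
  c_le : I.c ≤ C
  rule : IsDesignRule I.c C I.design
  tie_mem : ∀ S : Finset (Vec d), S.Nonempty → I.tie S ∈ S

namespace Input.IsValid

variable {I : Input d} {C : ℝ}

theorem C_pos (h : I.IsValid C) : 0 < C := h.c_pos.trans_le h.c_le

theorem one_le_T (h : I.IsValid C) : 1 ≤ I.T := by
  by_contra h0
  have := h.two_le
  simp [show I.T = 0 by omega] at this

theorem one_le_card (h : I.IsValid C) : 1 ≤ I.arms.card := by
  by_contra h0
  have := h.two_le
  simp [show I.arms.card = 0 by omega] at this

theorem arms_nonempty (h : I.IsValid C) : I.arms.Nonempty := Finset.card_pos.1 h.one_le_card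

theorem one_le_T_real (h : I.IsValid C) : (1 : ℝ) ≤ I.T := by exact_mod_cast h.one_le_T

theorem one_le_card_real (h : I.IsValid C) : (1 : ℝ) ≤ I.arms.card := by
  exact_mod_cast h.one_le_card

theorem one_le_d_real (h : I.IsValid C) : (1 : ℝ) ≤ d := by exact_mod_cast h.one_le_d

theorem two_le_real (h : I.IsValid C) : (2 : ℝ) ≤ I.arms.card * I.T := by
  exact_mod_cast h.two_le

theorem two_le_card_mul_sq (h : I.IsValid C) : (2 : ℝ) ≤ I.arms.card * (I.T : ℝ) ^ 2 := by
  nlinarith [h.two_le_real, h.one_le_T_real]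

theorem log_pos (h : I.IsValid C) : 0 < Real.log (I.arms.card * (I.T : ℝ) ^ 2) :=
  Real.log_pos (by linarith [h.two_le_card_mul_sq])

theorem q_pos (h : I.IsValid C) : 0 < I.q :=
  Real.rpow_pos_of_pos (div_pos (by linarith [h.one_le_T_real]) h.c_pos) _

theorem eps_pos (h : I.IsValid C) (i : ℕ) : 0 < I.eps i := by
  have h1 := h.log_pos
  have h2 := h.q_pos
  have h3 : (0 : ℝ) < d := by linarith [h.one_le_d_real]
  exact Real.sqrt_pos.2 (by positivity)

theorem delta_pos (h : I.IsValid C) : 0 < I.delta :=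
  one_div_pos.2 (by linarith [h.two_le_card_mul_sq])

theorem delta_le (h : I.IsValid C) : I.delta ≤ 1 / 2 :=
  one_div_le_one_div_of_le two_pos h.two_le_card_mul_sq

theorem design (h : I.IsValid C) {A : Finset (Vec d)} (hA : A.Nonempty) (i : ℕ) :
    IsDesign I.c C A (I.eps i) I.delta (I.design A (I.eps i) I.delta) :=
  h.rule A hA _ _ (h.eps_pos i) h.delta_pos h.delta_le

/-- With the chosen accuracies, batch `i` consists of at most `C max {d, q ^ i}` rounds. -/
theorem length_design_le (h : I.IsValid C) {A : Finset (Vec d)} (hA : A.Nonempty) (i : ℕ) :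
    ((I.design A (I.eps i) I.delta).length : ℝ) ≤ C * max (d : ℝ) (I.q ^ i) := by
  refine (h.design hA i).length_le.trans ?_
  have h1 := h.log_pos
  have h2 := h.q_pos
  have h3 : (0 : ℝ) < d := by linarith [h.one_le_d_real]
  have h4 : (d : ℝ) * (Real.log (1 / I.delta) / I.eps i ^ 2) = I.q ^ i := by
    rw [Input.delta, one_div_one_div, Input.eps, Real.sq_sqrt (by positivity)]
    field_simp
  have h5 : (rk A : ℝ) ≤ d := by exact_mod_cast rk_le A
  rw [h4]
  have := h.C_pos
  gcongr

end Input.IsValid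

/-! ### Shape of the batches -/

theorem eliminate_subset (A : Finset (Vec d)) (θ : Vec d) (ε : ℝ) : eliminate A θ ε ⊆ A :=
  Finset.filter_subset _ _

theorem maximizers_subset (A : Finset (Vec d)) (θ : Vec d) : maximizers A θ ⊆ A :=
  Finset.filter_subset _ _

theorem maximizers_nonempty {A : Finset (Vec d)} (hA : A.Nonempty) (θ : Vec d) :
    (maximizers A θ).Nonempty := by
  obtain ⟨a, ha, hmax⟩ := A.exists_max_image (fun a => (inner ℝ a θ : ℝ)) hA
  exact ⟨a, by simpa [maximizers] using ⟨ha, hmax⟩⟩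

theorem eliminate_nonempty {A : Finset (Vec d)} (hA : A.Nonempty) (θ : Vec d) {ε : ℝ}
    (hε : 0 ≤ ε) : (eliminate A θ ε).Nonempty := by
  obtain ⟨a, ha, hmax⟩ := A.exists_max_image (fun a => (inner ℝ a θ : ℝ)) hA
  refine ⟨a, ?_⟩
  simp only [eliminate, Finset.mem_filter, not_exists, not_and, not_lt]
  exact ⟨ha, fun b hb => by linarith [hmax b hb]⟩

theorem Input.length_batchesFrom_le (I : Input d) (r : ℕ → Vec d → ℝ) (m : ℕ) :
    ∀ i t A θ, (I.batchesFrom r m i t A θ).length ≤ m + 1 := by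
  induction m with
  | zero => intro i t A θ; simp [Input.batchesFrom]
  | succ m ih =>
    intro i t A θ
    simp only [Input.batchesFrom]
    split_ifs
    · simp
    · simpa using ih _ _ _ _

theorem Input.length_flatten_batchesFrom (I : Input d) (r : ℕ → Vec d → ℝ) (m : ℕ) :
    ∀ i t A θ, t ≤ I.T → (I.batchesFrom r m i t A θ).flatten.length = I.T - t := by
  induction m with
  | zero => intro i t A θ _; simp [Input.batchesFrom]
  | succ m ih =>
    intro i t A θ ht
    simp only [Input.batchesFrom]
    split_ifs with h
    · simp
    · rw [List.flatten_cons, List.length_append, ih _ _ _ _ (by omega)]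
      omega

theorem Input.mem_of_mem_batchesFrom {I : Input d} {C : ℝ} (hI : I.IsValid C)
    (r : ℕ → Vec d → ℝ) (m : ℕ) : ∀ i t A θ, A.Nonempty →
      ∀ a ∈ (I.batchesFrom r m i t A θ).flatten, a ∈ A := by
  have hlast : ∀ (n : ℕ) (A : Finset (Vec d)) (θ : Vec d), A.Nonempty →
      ∀ a ∈ [List.replicate n (I.tie (maximizers A θ))].flatten, a ∈ A := by
    intro n A θ hA a ha
    rw [List.flatten_singleton] at ha
    rw [List.eq_of_mem_replicate ha]
    exact maximizers_subset A θ (hI.tie_mem _ (maximizers_nonempty hA θ))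
  induction m with
  | zero => intro i t A θ hA; exact hlast _ A θ hA
  | succ m ih =>
    intro i t A θ hA a ha
    simp only [Input.batchesFrom] at ha
    split_ifs at ha with h
    · exact hlast _ A θ hA a ha
    · rw [List.flatten_cons, List.mem_append] at ha
      rcases ha with ha | ha
      · exact (hI.design hA i).mem a ha
      · exact eliminate_subset _ _ _ (ih _ _ _ _ (eliminate_nonempty hA _ (hI.eps_pos i).le) a ha)

/-! ### Regret when all estimates are accurate -/

/-- In all batches that are played from batch `i` on, the estimate is accurate for every active
arm. The arguments have the same meaning as for `Input.batchesFrom`. -/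
def Input.Good (I : Input d) (θ : Vec d) (r : ℕ → Vec d → ℝ) :
    (m i t : ℕ) → Finset (Vec d) → Prop
  | 0, _, _, _ => True
  | m + 1, i, t, A =>
    let S := I.design A (I.eps i) I.delta
    let θ' := leastSquares S fun j => r (t + j) (S.get j)
    S.length ≤ I.T - t → (∀ a ∈ A, |(inner ℝ a (θ' - θ) : ℝ)| ≤ I.eps i) ∧
      I.Good θ r m (i + 1) (t + S.length) (eliminate A θ' (I.eps i))

theorem mem_eliminate_of_isMax {A : Finset (Vec d)} {θ θ' : Vec d} {ε : ℝ}
    (h : ∀ a ∈ A, |(inner ℝ a (θ' - θ) : ℝ)| ≤ ε) {b : Vec d} (hb : b ∈ A)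
    (hmax : ∀ a ∈ A, (inner ℝ a θ : ℝ) ≤ inner ℝ b θ) : b ∈ eliminate A θ' ε := by
  simp only [eliminate, Finset.mem_filter, not_exists, not_and, not_lt]
  refine ⟨hb, fun a ha => ?_⟩
  have h1 := abs_le.1 (h a ha)
  have h2 := abs_le.1 (h b hb)
  rw [inner_sub_right] at h1 h2
  linarith [hmax a ha]

theorem gap_le_of_mem_eliminate {A : Finset (Vec d)} {θ θ' : Vec d} {ε : ℝ}
    (h : ∀ a ∈ A, |(inner ℝ a (θ' - θ) : ℝ)| ≤ ε) {b : Vec d} (hb : b ∈ A) {a : Vec d}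
    (ha : a ∈ eliminate A θ' ε) : (inner ℝ b θ - inner ℝ a θ : ℝ) ≤ 4 * ε := by
  simp only [eliminate, Finset.mem_filter, not_exists, not_and, not_lt] at ha
  have h1 := abs_le.1 (h a ha.1)
  have h2 := abs_le.1 (h b hb)
  rw [inner_sub_right] at h1 h2
  linarith [ha.2 b hb]

theorem sum_map_le_length_mul {l : List (Vec d)} {f : Vec d → ℝ} {g : ℝ}
    (h : ∀ a ∈ l, f a ≤ g) : (l.map f).sum ≤ l.length * g := by
  have := List.sum_le_card_nsmul (l.map f) g (by simpa using h)
  simpa using this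

/-- The part of the regret bound that is due to batches of `C q ^ i` rounds and to the last batch,
when the active arms have gap at most `g` in the first of these batches, and at most `4 ε_i` after
batch `i`. -/
noncomputable def Input.cost (I : Input d) (C : ℝ) : (m i : ℕ) → ℝ → ℝ
  | 0, _, g => I.T * g
  | m + 1, i, g => C * I.q ^ i * g + I.cost C m (i + 1) (4 * I.eps i)

theorem Input.cost_nonneg {I : Input d} {C : ℝ} (hI : I.IsValid C) (m : ℕ) :
    ∀ i g, 0 ≤ g → 0 ≤ I.cost C m i g := by
  induction m with
  | zero => intro i g hg; simp only [Input.cost]; positivity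
  | succ m ih =>
    intro i g hg
    have h1 := hI.q_pos
    have h2 := hI.C_pos
    have h3 := ih (i + 1) (4 * I.eps i) (by linarith [hI.eps_pos i])
    simp only [Input.cost]
    positivity

/-- A batch of at most `C max {d, q ^ i}` rounds with gaps at most `min {2, g}` is either charged
twice its length, which then is at most `C d`, or `C q ^ i g`. -/
theorem batch_regret_le {C D Q g n ρ : ℝ} (hn : 0 ≤ n) (hC : 0 < C) (hD : 0 ≤ D) (hQ : 0 ≤ Q)
    (hg : 0 ≤ g) (hlen : n ≤ C * max D Q) (h2 : ρ ≤ n * 2) (hρ : ρ ≤ n * g) :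
    ∃ y, 0 ≤ y ∧ y ≤ n ∧ y ≤ C * D ∧ ρ ≤ 2 * y + C * Q * g := by
  rcases le_or_gt n (C * D) with h | h
  · exact ⟨n, hn, le_rfl, h, by nlinarith [mul_nonneg (mul_nonneg hC.le hQ) hg]⟩
  · refine ⟨0, le_rfl, hn, by positivity, ?_⟩
    have h' : D ≤ Q := by
      by_contra hQD
      rw [max_eq_left (not_le.1 hQD).le] at hlen
      linarith
    rw [max_eq_right h'] at hlen
    nlinarith

theorem Input.regret_flatten_le {I : Input d} {C : ℝ} (hI : I.IsValid C) {θ b : Vec d}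
    (r : ℕ → Vec d → ℝ) (m : ℕ) : ∀ i t A θ₀ g, t ≤ I.T → 0 ≤ g → I.Good θ r m i t A → b ∈ A →
      (∀ a ∈ A, (inner ℝ a θ : ℝ) ≤ inner ℝ b θ) →
      (∀ a ∈ A, (inner ℝ b θ - inner ℝ a θ : ℝ) ≤ 2) →
      (∀ a ∈ A, (inner ℝ b θ - inner ℝ a θ : ℝ) ≤ g) →
      ∃ x : ℝ, 0 ≤ x ∧ x ≤ I.T - t ∧ x ≤ m * (C * d) ∧
        (((I.batchesFrom r m i t A θ₀).flatten).map
          fun a => (inner ℝ b θ - inner ℝ a θ : ℝ)).sum ≤ 2 * x + I.cost C m i g := by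
  have hC := hI.C_pos
  have hq := hI.q_pos
  have hd : (0 : ℝ) ≤ d := Nat.cast_nonneg d
  have hlast : ∀ (n : ℕ) (A : Finset (Vec d)) (θ₀ : Vec d) (g : ℝ), A.Nonempty →
      (∀ a ∈ A, (inner ℝ b θ - inner ℝ a θ : ℝ) ≤ g) →
      ([List.replicate n (I.tie (maximizers A θ₀))].flatten.map
          fun a => (inner ℝ b θ - inner ℝ a θ : ℝ)).sum ≤ n * g := by
    intro n A θ₀ g hA hg
    refine (sum_map_le_length_mul (g := g) fun a ha => hg a ?_).trans (by simp)
    rw [List.flatten_singleton] at ha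
    rw [List.eq_of_mem_replicate ha]
    exact maximizers_subset A θ₀ (hI.tie_mem _ (maximizers_nonempty hA θ₀))
  induction m with
  | zero =>
    intro i t A θ₀ g ht hg _ hb _ _ hgap
    have ht' : (t : ℝ) ≤ I.T := by exact_mod_cast ht
    refine ⟨0, le_rfl, by linarith, by simp, ?_⟩
    refine (hlast _ A θ₀ g ⟨b, hb⟩ hgap).trans ?_
    have : ((I.T - t : ℕ) : ℝ) ≤ I.T := by exact_mod_cast Nat.sub_le _ _
    simp only [Input.cost]
    nlinarith
  | succ m ih =>
    intro i t A θ₀ g ht hg hgood hb hmax hgap2 hgap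
    have hA : A.Nonempty := ⟨b, hb⟩
    have hlen := hI.length_design_le hA i
    have hε := hI.eps_pos i
    have hcast : ((m + 1 : ℕ) : ℝ) * (C * d) = m * (C * d) + C * d := by push_cast; ring
    have hm : 0 ≤ (m : ℝ) * (C * d) := by positivity
    simp only [Input.batchesFrom, Input.cost]
    simp only [Input.Good] at hgood
    set S := I.design A (I.eps i) I.delta
    set θ' := leastSquares S fun j => r (t + j) (S.get j)
    split_ifs with h
    · obtain ⟨y, hy0, hyn, hyC, hy⟩ := batch_regret_le (n := ((I.T - t : ℕ) : ℝ))
        (Nat.cast_nonneg _) hC hd (pow_nonneg hq.le i) hg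
        (le_trans (by exact_mod_cast h.le) hlen)
        (hlast _ A θ₀ 2 hA hgap2) (hlast _ A θ₀ g hA hgap)
      refine ⟨y, hy0, by rwa [← Nat.cast_sub ht], by rw [hcast]; linarith, ?_⟩
      linarith [I.cost_nonneg hI m (i + 1) (4 * I.eps i) (by linarith)]
    · obtain ⟨hacc, hgood'⟩ := hgood (not_lt.1 h)
      have hsub := eliminate_subset A θ' (I.eps i)
      obtain ⟨x, hx0, hxT, hxC, hx⟩ := ih (i + 1) (t + S.length) _ θ' (4 * I.eps i) (by omega)
        (by linarith) hgood' (mem_eliminate_of_isMax hacc hb hmax)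
        (fun a ha => hmax a (hsub ha)) (fun a ha => hgap2 a (hsub ha))
        (fun a ha => gap_le_of_mem_eliminate hacc hb ha)
      have hS := fun a ha => (hI.design hA i).mem a ha
      obtain ⟨y, hy0, hyn, hyC, hy⟩ := batch_regret_le (n := (S.length : ℝ))
        (Nat.cast_nonneg _) hC hd (pow_nonneg hq.le i) hg hlen
        (sum_map_le_length_mul fun a ha => hgap2 a (hS a ha))
        (sum_map_le_length_mul fun a ha => hgap a (hS a ha))
      push_cast at hxT
      refine ⟨y + x, by positivity, by linarith, by rw [hcast]; linarith, ?_⟩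
      rw [List.flatten_cons, List.map_append, List.sum_append]
      linarith

/-! ### Measurability -/

section Measurability

variable {Ω : Type*} {mΩ : MeasurableSpace Ω}

theorem measurableSet_forall_mem {α : Type*} (A : Finset α) {p : α → Ω → Prop}
    (h : ∀ a ∈ A, MeasurableSet {ω | p a ω}) : MeasurableSet {ω | ∀ a ∈ A, p a ω} := by
  have : {ω | ∀ a ∈ A, p a ω} = ⋂ a ∈ A, {ω | p a ω} := by ext; simp
  rw [this]
  exact Finset.measurableSet_biInter _ h

theorem measurableSet_eliminate_eq (A A' : Finset (Vec d)) (ε : ℝ) :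
    MeasurableSet {θ : Vec d | eliminate A θ ε = A'} := by
  by_cases hA' : A' ⊆ A
  · have h : {θ : Vec d | eliminate A θ ε = A'}
        = {θ | ∀ a ∈ A, a ∈ A' ↔ ∀ b ∈ A, (inner ℝ b θ - 2 * ε : ℝ) ≤ inner ℝ a θ} := by
      ext θ
      rw [Set.mem_ofPred_eq, Finset.ext_iff]
      simp only [eliminate, Finset.mem_filter, not_exists, not_and, not_lt, Set.mem_ofPred_eq]
      refine ⟨fun H a ha => by rw [← H a]; simp [ha], fun H a => ?_⟩
      exact ⟨fun ha => (H a ha.1).2 ha.2, fun ha => ⟨hA' ha, (H a (hA' ha)).1 ha⟩⟩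
    rw [h]
    refine measurableSet_forall_mem A fun a _ => MeasurableSet.iff (.const _) ?_
    exact measurableSet_forall_mem A fun b _ => measurableSet_le (by fun_prop) (by fun_prop)
  · convert MeasurableSet.empty
    ext θ
    simp only [Set.mem_ofPred_eq, Set.mem_empty_iff_false, iff_false]
    rintro rfl
    exact hA' (eliminate_subset _ _ _)

theorem measurableSet_maximizers_eq (A A' : Finset (Vec d)) :
    MeasurableSet {θ : Vec d | maximizers A θ = A'} := by
  convert measurableSet_eliminate_eq A A' 0 using 3 with θ
  simp [maximizers, eliminate]

/-- A quantity that depends on a random finite set with finitely many values is measurable if it is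
measurable for each of these values. -/
theorem measurable_of_finset_valued {A : Finset (Vec d)} {Y : Ω → Finset (Vec d)}
    (hY : ∀ ω, Y ω ⊆ A) (hm : ∀ A', MeasurableSet {ω | Y ω = A'}) {F : Finset (Vec d) → Ω → ℝ}
    (hF : ∀ A', Measurable (F A')) : Measurable fun ω => F (Y ω) ω := by
  classical
  have h : (fun ω => F (Y ω) ω)
      = fun ω => ∑ A' ∈ A.powerset, {ω | Y ω = A'}.indicator (F A') ω := by
    ext1 ω
    rw [Finset.sum_eq_single (Y ω)]
    · simp
    · intro A' _ hne
      exact Set.indicator_of_notMem (fun h => hne h.symm) _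
    · intro h
      exact (h (Finset.mem_powerset.2 (hY ω))).elim
  rw [h]
  exact Finset.measurable_sum _ fun A' _ => (hF A').indicator (hm A')

theorem measurable_leastSquares (S : List (Vec d)) : Measurable (leastSquares S) := by
  unfold leastSquares
  exact (gramInv S).continuous.measurable.comp
    (Finset.measurable_sum _ fun j _ => (measurable_pi_apply j).smul_const _)

theorem measurable_estimate (S : List (Vec d)) (θ : Vec d) {η : ℕ → Ω → ℝ} {t : ℕ}
    (hη : ∀ j, j < S.length → Measurable (η (t + j))) :
    Measurable fun ω => leastSquares S fun j => rewards θ η ω (t + j) (S.get j) := by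
  refine (measurable_leastSquares S).comp (measurable_pi_lambda _ fun j => ?_)
  exact (hη j j.2).const_add _

theorem measurable_gain_batchesFrom (I : Input d) (θ : Vec d) {η : ℕ → Ω → ℝ}
    (hη : ∀ s, Measurable (η s)) (m : ℕ) :
    ∀ i t A (θ₀ : Ω → Vec d), Measurable θ₀ →
      Measurable fun ω => (((I.batchesFrom (rewards θ η ω) m i t A (θ₀ ω)).flatten).map
        fun a => (inner ℝ a θ : ℝ)).sum := by
  have hlast : ∀ (n : ℕ) (A : Finset (Vec d)) (θ₀ : Ω → Vec d), Measurable θ₀ →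
      Measurable fun ω => ([List.replicate n (I.tie (maximizers A (θ₀ ω)))].flatten.map
        fun a => (inner ℝ a θ : ℝ)).sum := fun n A θ₀ hθ₀ =>
    measurable_of_finset_valued (fun ω => maximizers_subset A (θ₀ ω))
      (fun A' => hθ₀ (measurableSet_maximizers_eq A A'))
      (F := fun A' _ => ([List.replicate n (I.tie A')].flatten.map
        fun a => (inner ℝ a θ : ℝ)).sum) fun _ => measurable_const
  induction m with
  | zero => intro i t A θ₀ hθ₀; exact hlast _ A θ₀ hθ₀
  | succ m ih =>
    intro i t A θ₀ hθ₀
    simp only [Input.batchesFrom]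
    split_ifs with h
    · exact hlast _ A θ₀ hθ₀
    · have hθ' := measurable_estimate (I.design A (I.eps i) I.delta) θ (η := η) (t := t)
        fun j _ => hη (t + j)
      simp only [List.flatten_cons, List.map_append, List.sum_append]
      refine Measurable.const_add ?_ _
      exact measurable_of_finset_valued (fun ω => eliminate_subset A _ (I.eps i))
        (fun A' => hθ' (measurableSet_eliminate_eq A A' (I.eps i))) fun A' => ih _ _ A' _ hθ'

theorem measurableSet_accurate (S : List (Vec d)) (a θ : Vec d) (ε : ℝ) :
    MeasurableSet {x : Fin S.length → ℝ |
      |(inner ℝ a (leastSquares S (fun j => inner ℝ (S.get j) θ + x j) - θ) : ℝ)| ≤ ε} := by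
  have h : Measurable fun x : Fin S.length → ℝ =>
      leastSquares S (fun j => inner ℝ (S.get j) θ + x j) :=
    (measurable_leastSquares S).comp
      (measurable_pi_lambda _ fun j => (measurable_pi_apply j).const_add _)
  exact measurableSet_le (by fun_prop) measurable_const

theorem measurableSet_good (I : Input d) (θ : Vec d) {η : ℕ → Ω → ℝ} (m : ℕ) :
    ∀ i t A, (∀ s, t ≤ s → Measurable (η s)) →
      MeasurableSet {ω | I.Good θ (rewards θ η ω) m i t A} := by
  induction m with
  | zero => intro i t A _; simp [Input.Good]
  | succ m ih =>
    intro i t A hη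
    simp only [Input.Good]
    have hθ' := measurable_estimate (I.design A (I.eps i) I.delta) θ (η := η) (t := t)
      fun j _ => hη (t + j) (Nat.le_add_right _ _)
    have hacc := measurableSet_forall_mem A (p := fun a ω => |(inner ℝ a
      ((leastSquares (I.design A (I.eps i) I.delta) fun j => rewards θ η ω (t + j)
        ((I.design A (I.eps i) I.delta).get j)) - θ) : ℝ)| ≤ I.eps i)
      fun a _ => measurableSet_le (by fun_prop) measurable_const
    have hrest : MeasurableSet {ω | I.Good θ (rewards θ η ω) m (i + 1)
        (t + (I.design A (I.eps i) I.delta).length) (eliminate A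
          (leastSquares (I.design A (I.eps i) I.delta) fun j => rewards θ η ω (t + j)
            ((I.design A (I.eps i) I.delta).get j)) (I.eps i))} := by
      have h : ∀ A', MeasurableSet {ω | I.Good θ (rewards θ η ω) m (i + 1)
          (t + (I.design A (I.eps i) I.delta).length) A'} :=
        fun A' => ih _ _ A' fun s hs => hη s (by omega)
      classical
      have h2 := measurable_of_finset_valued (fun ω => eliminate_subset A _ (I.eps i))
        (fun A' => hθ' (measurableSet_eliminate_eq A A' (I.eps i)))
        (F := fun A' => Set.indicator {ω | I.Good θ (rewards θ η ω) m (i + 1)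
          (t + (I.design A (I.eps i) I.delta).length) A'} 1)
        fun A' => measurable_one.indicator (h A')
      convert h2 (measurableSet_singleton 1) using 2
      ext ω
      simp [Set.indicator_apply]
    exact MeasurableSet.imp (.const _) (hacc.inter hrest)

end Measurability

/-! ### Probability that all estimates are accurate -/

section Probability

variable {Ω : Type*} [MeasurableSpace Ω] {P : Measure Ω} [IsProbabilityMeasure P]
  {η : ℕ → Ω → ℝ}

/-- A design that is played in the rounds from `t` on is accurate. -/
theorem prob_not_accurate_le (hη : ∀ t, Measurable (η t)) (hind : iIndepFun η P)
    (hlaw : ∀ t, IsNoiseLaw (P.map (η t))) {A : Finset (Vec d)} {ε δ : ℝ} {S : List (Vec d)}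
    (hS : IsAccurate A ε δ S) {θ : Vec d} (hθ : ‖θ‖ ≤ 1) (t : ℕ) {a : Vec d} (ha : a ∈ A) :
    P.real {ω | ¬ |(inner ℝ a ((leastSquares S fun j => rewards θ η ω (t + j) (S.get j)) - θ) : ℝ)|
      ≤ ε} ≤ δ := by
  have hinj : Function.Injective fun j : Fin S.length => t + (j : ℕ) := fun j k hjk => by
    ext; simpa using hjk
  have hmap := ((hind.precomp hinj).map_fun_eq_pi_map fun j => (hη _).aemeasurable)
  have hacc := hS θ hθ (fun j => P.map (η (t + j))) (fun j => hlaw _) a ha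
  have hms := measurableSet_accurate S a θ ε
  have hmeas : Measurable fun ω (j : Fin S.length) => η (t + j) ω :=
    measurable_pi_lambda _ fun j => hη _
  rw [← hmap, map_measureReal_apply hmeas hms] at hacc
  have := probReal_compl_eq_one_sub (μ := P) (hmeas hms)
  refine le_trans (le_of_eq ?_) (this.trans_le (by linarith : _ ≤ δ))
  rfl

/-- The probability that some estimate is inaccurate is at most `m K δ`. The arms that survive a
batch depend only on the noises up to this batch, and take finitely many values, whereas for a
fixed set of surviving arms the later estimates depend only on the later noises. -/
theorem prob_not_good_le {I : Input d} {C : ℝ} (hI : I.IsValid C) (hη : ∀ t, Measurable (η t))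
    (hind : iIndepFun η P) (hlaw : ∀ t, IsNoiseLaw (P.map (η t))) {θ : Vec d} (hθ : ‖θ‖ ≤ 1)
    (m : ℕ) : ∀ i t A, A.Nonempty → A ⊆ I.arms →
      P.real {ω | ¬ I.Good θ (rewards θ η ω) m i t A} ≤ m * (I.arms.card * I.delta) := by
  classical
  have hδ := hI.delta_pos
  induction m with
  | zero => intro i t A _ _; simp [Input.Good]
  | succ m ih =>
    intro i t A hA hsub
    set S := I.design A (I.eps i) I.delta with hS
    set est : Ω → Vec d := fun ω => leastSquares S fun j => rewards θ η ω (t + j) (S.get j)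
      with hest
    have hest_meas : Measurable est := measurable_estimate S θ fun j _ => hη _
    let E : Finset (Vec d) → Set Ω := fun A' => {ω | eliminate A (est ω) (I.eps i) = A'}
    have hE : ∀ A', MeasurableSet (E A') := fun A' =>
      hest_meas (measurableSet_eliminate_eq A A' (I.eps i))
    let Bad : Finset (Vec d) → Set Ω := fun A' =>
      {ω | ¬ I.Good θ (rewards θ η ω) m (i + 1) (t + S.length) A'}
    let N : Finset (Finset (Vec d)) := A.powerset.filter Finset.Nonempty
    have hincl : {ω | ¬ I.Good θ (rewards θ η ω) (m + 1) i t A} ⊆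
        (⋃ a ∈ A, {ω | ¬ |(inner ℝ a (est ω - θ) : ℝ)| ≤ I.eps i}) ∪ ⋃ A' ∈ N, E A' ∩ Bad A' := by
      intro ω hω
      simp only [Input.Good, Set.mem_ofPred_eq, Classical.not_imp, not_and_or] at hω
      rcases hω.2 with h | h
      · left
        push Not at h
        obtain ⟨a, ha, h⟩ := h
        exact Set.mem_biUnion ha (not_le.2 h)
      · right
        refine Set.mem_biUnion (x := eliminate A (est ω) (I.eps i)) ?_ ⟨rfl, h⟩
        exact Finset.mem_filter.2 ⟨Finset.mem_powerset.2 (eliminate_subset _ _ _),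
          eliminate_nonempty hA _ (hI.eps_pos i).le⟩
    have h1 : P.real (⋃ a ∈ A, {ω | ¬ |(inner ℝ a (est ω - θ) : ℝ)| ≤ I.eps i})
        ≤ I.arms.card * I.delta := by
      refine (measureReal_biUnion_finset_le _ _).trans ?_
      refine (Finset.sum_le_card_nsmul _ _ I.delta fun a ha =>
        prob_not_accurate_le hη hind hlaw (hI.design hA i).accurate hθ t ha).trans ?_
      rw [nsmul_eq_mul]
      gcongr
    have hindep : ∀ A', P.real (E A' ∩ Bad A') = P.real (E A') * P.real (Bad A') := by
      intro A'
      let σ : ℕ → MeasurableSpace Ω := fun s => MeasurableSpace.comap (η s) inferInstance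
      have hdisj : Disjoint (Set.Iio (t + S.length)) (Set.Ici (t + S.length)) :=
        Set.disjoint_left.2 fun s h1 h2 => absurd (Set.mem_Iio.1 h1) (not_lt.2 h2)
      have hI' := indep_iSup_of_disjoint (fun s => (hη s).comap_le) hind.iIndep hdisj
      have hle : ∀ (U : Set ℕ) (s : ℕ), s ∈ U →
          @Measurable Ω ℝ (⨆ s ∈ U, σ s) _ (η s) := fun U s hs =>
        (comap_measurable (η s)).mono (le_iSup₂_of_le s hs le_rfl) le_rfl
      have hE' : MeasurableSet[⨆ s ∈ Set.Iio (t + S.length), σ s] (E A') :=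
        measurable_estimate (mΩ := ⨆ s ∈ Set.Iio (t + S.length), σ s) S θ
          (fun j hj => hle _ _ (Set.mem_Iio.2 (by omega)))
          (measurableSet_eliminate_eq A A' (I.eps i))
      have hB' : MeasurableSet[⨆ s ∈ Set.Ici (t + S.length), σ s] (Bad A') :=
        (measurableSet_good (mΩ := ⨆ s ∈ Set.Ici (t + S.length), σ s) I θ m _ _ A'
          (fun s hs => hle _ _ hs)).compl
      have := (Indep_iff _ _ _).1 hI' _ _ hE' hB'
      rw [Measure.real, this, ENNReal.toReal_mul]
      rfl
    have h2 : P.real (⋃ A' ∈ N, E A' ∩ Bad A') ≤ m * (I.arms.card * I.delta) := by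
      refine (measureReal_biUnion_finset_le _ _).trans ?_
      have h3 : ∑ A' ∈ N, P.real (E A') ≤ 1 := by
        rw [← measureReal_biUnion_finset (fun A₁ _ A₂ _ hne => ?_) fun A' _ => hE A']
        · exact measureReal_le_one
        · exact Set.disjoint_left.2 fun ω h1 h2 => hne (Eq.trans (Eq.symm h1) h2)
      have hnn : (0 : ℝ) ≤ m * (I.arms.card * I.delta) := by positivity
      calc ∑ A' ∈ N, P.real (E A' ∩ Bad A')
          ≤ ∑ A' ∈ N, P.real (E A') * (m * (I.arms.card * I.delta)) := by
            refine Finset.sum_le_sum fun A' hA' => ?_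
            obtain ⟨hp, hne⟩ := Finset.mem_filter.1 hA'
            rw [hindep]
            exact mul_le_mul_of_nonneg_left
              (ih _ _ A' hne ((Finset.mem_powerset.1 hp).trans hsub)) measureReal_nonneg
        _ ≤ 1 * (m * (I.arms.card * I.delta)) := by
            rw [← Finset.sum_mul]
            exact mul_le_mul_of_nonneg_right h3 hnn
        _ = m * (I.arms.card * I.delta) := one_mul _
    refine (measureReal_mono hincl).trans ((measureReal_union_le _ _).trans ?_)
    push_cast
    linarith

end Probability

/-! ### Expected regret in terms of the deterministic bound -/

section Expectation

variable {Ω : Type*} {I : Input d} {C : ℝ} {θ : Vec d} {η : ℕ → Ω → ℝ}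

theorem Input.IsValid.abs_inner_le (hI : I.IsValid C) (hθ : ‖θ‖ ≤ 1) {a : Vec d}
    (ha : a ∈ I.arms) : |(inner ℝ a θ : ℝ)| ≤ 1 :=
  (abs_real_inner_le_norm a θ).trans
    (mul_le_one₀ (hI.norm_le a ha) (norm_nonneg _) hθ)

theorem Input.length_played (I : Input d) (θ : Vec d) (η : ℕ → Ω → ℝ) (ω : Ω) :
    (I.played θ η ω).length = I.T := by
  rw [Input.played, Input.batches, I.length_flatten_batchesFrom _ _ _ _ _ _ (Nat.zero_le _),
    Nat.sub_zero]

theorem Input.IsValid.mem_arms (hI : I.IsValid C) (ω : Ω) : ∀ a ∈ I.played θ η ω, a ∈ I.arms :=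
  Input.mem_of_mem_batchesFrom hI _ _ _ _ _ _ hI.arms_nonempty

theorem Input.mul_sub_gain (I : Input d) (θ : Vec d) (η : ℕ → Ω → ℝ) (ω : Ω) (v : ℝ) :
    I.T * v - I.gain θ η ω = ((I.played θ η ω).map fun a => v - inner ℝ a θ).sum := by
  rw [← I.length_played θ η ω, Input.gain]
  induction I.played θ η ω with
  | nil => simp
  | cons a l ih =>
    simp only [List.length_cons, List.map_cons, List.sum_cons, ← ih]
    push_cast
    ring

theorem Input.IsValid.mul_sub_gain_le (hI : I.IsValid C) (hθ : ‖θ‖ ≤ 1) {b : Vec d}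
    (hb : b ∈ I.arms) (ω : Ω) : I.T * inner ℝ b θ - I.gain θ η ω ≤ I.T * 2 := by
  rw [I.mul_sub_gain θ η ω]
  refine (sum_map_le_length_mul (g := 2) fun a ha => ?_).trans_eq (by rw [I.length_played])
  have h1 := abs_le.1 (hI.abs_inner_le hθ hb)
  have h2 := abs_le.1 (hI.abs_inner_le hθ (hI.mem_arms ω a ha))
  linarith

theorem Input.IsValid.exists_isMax (hI : I.IsValid C) (θ : Vec d) :
    ∃ b ∈ I.arms, (∀ a ∈ I.arms, (inner ℝ a θ : ℝ) ≤ inner ℝ b θ) ∧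
      ⨆ a : I.arms, (inner ℝ (a : Vec d) θ : ℝ) = inner ℝ b θ := by
  obtain ⟨b, hb, hmax⟩ :=
    I.arms.exists_max_image (fun a => (inner ℝ a θ : ℝ)) hI.arms_nonempty
  have : Nonempty I.arms := ⟨⟨b, hb⟩⟩
  refine ⟨b, hb, hmax, le_antisymm (ciSup_le fun a => hmax a a.2) ?_⟩
  exact le_ciSup (f := fun a : I.arms => (inner ℝ (a : Vec d) θ : ℝ))
    (Set.finite_range _).bddAbove ⟨b, hb⟩

theorem Input.IsValid.mul_sub_gain_le_of_good (hI : I.IsValid C) (hθ : ‖θ‖ ≤ 1) {b : Vec d}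
    (hb : b ∈ I.arms) (hmax : ∀ a ∈ I.arms, (inner ℝ a θ : ℝ) ≤ inner ℝ b θ) {ω : Ω}
    (hgood : I.Good θ (rewards θ η ω) (I.B - 1) 1 0 I.arms) :
    I.T * inner ℝ b θ - I.gain θ η ω
      ≤ 2 * √(I.T * (I.B * (C * d))) + I.cost C (I.B - 1) 1 2 := by
  have h2 : ∀ a ∈ I.arms, (inner ℝ b θ - inner ℝ a θ : ℝ) ≤ 2 := fun a ha => by
    have h1 := abs_le.1 (hI.abs_inner_le hθ hb)
    have h2 := abs_le.1 (hI.abs_inner_le hθ ha)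
    linarith
  obtain ⟨x, hx0, hxT, hxB, hx⟩ := Input.regret_flatten_le hI _ (I.B - 1) 1 0 I.arms 0 2
    (Nat.zero_le _) zero_le_two hgood hb hmax h2 h2
  rw [I.mul_sub_gain θ η ω]
  refine hx.trans ?_
  have hC := hI.C_pos
  have hB : ((I.B - 1 : ℕ) : ℝ) * (C * d) ≤ I.B * (C * d) := by
    have : ((I.B - 1 : ℕ) : ℝ) ≤ I.B := by exact_mod_cast Nat.sub_le _ _
    gcongr
  have hxs : x ≤ √(I.T * (I.B * (C * d))) := by
    refine Real.le_sqrt_of_sq_le ?_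
    rw [sq]
    push_cast at hxT
    exact mul_le_mul (by linarith) (hxB.trans hB) hx0 (Nat.cast_nonneg _)
  linarith

variable [MeasurableSpace Ω] {P : Measure Ω} [IsProbabilityMeasure P]

theorem Input.IsValid.integrable_gain (hI : I.IsValid C) (hθ : ‖θ‖ ≤ 1)
    (hη : ∀ t, Measurable (η t)) : Integrable (I.gain θ η) P := by
  have hm : Measurable (I.gain θ η) :=
    measurable_gain_batchesFrom I θ hη (I.B - 1) 1 0 I.arms (fun _ => 0) measurable_const
  refine Integrable.of_bound hm.aestronglyMeasurable I.T (.of_forall fun ω => ?_)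
  have hsum : ∀ l : List (Vec d), (∀ a ∈ l, a ∈ I.arms) →
      |(l.map fun a => (inner ℝ a θ : ℝ)).sum| ≤ l.length := by
    intro l hl
    have h1 := sum_map_le_length_mul (l := l) (f := fun a => (inner ℝ a θ : ℝ)) (g := 1)
      fun a ha => (abs_le.1 (hI.abs_inner_le hθ (hl a ha))).2
    have h2 := sum_map_le_length_mul (l := l) (f := fun a => -(inner ℝ a θ : ℝ)) (g := 1)
      fun a ha => by linarith [(abs_le.1 (hI.abs_inner_le hθ (hl a ha))).1]
    have h3 : (l.map fun a => -(inner ℝ a θ : ℝ)).sum = -(l.map fun a => (inner ℝ a θ : ℝ)).sum := by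
      rw [List.sum_neg, List.map_map]; rfl
    rw [h3] at h2
    exact abs_le.2 ⟨by linarith, by linarith⟩
  rw [Real.norm_eq_abs]
  exact (hsum _ (hI.mem_arms ω)).trans_eq (by rw [I.length_played])

theorem Input.IsValid.regret_le_two_mul (hI : I.IsValid C) (hθ : ‖θ‖ ≤ 1)
    (hη : ∀ t, Measurable (η t)) : I.regret P θ η ≤ I.T * 2 := by
  obtain ⟨b, hb, -, hsup⟩ := hI.exists_isMax θ
  have h := integral_mono (μ := P) (integrable_const (I.T * inner ℝ b θ - I.T * 2))
    (hI.integrable_gain hθ hη)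
    fun ω => by linarith [hI.mul_sub_gain_le (η := η) hθ hb ω]
  rw [integral_const, probReal_univ, one_smul] at h
  rw [Input.regret, hsup]
  linarith

theorem Input.IsValid.regret_le_cost (hI : I.IsValid C) (hθ : ‖θ‖ ≤ 1)
    (hη : ∀ t, Measurable (η t)) (hind : iIndepFun η P) (hlaw : ∀ t, IsNoiseLaw (P.map (η t))) :
    I.regret P θ η
      ≤ 2 * √(I.T * (I.B * (C * d))) + I.cost C (I.B - 1) 1 2 + 2 * (I.B / I.T) := by
  obtain ⟨b, hb, hmax, hsup⟩ := hI.exists_isMax θ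
  set R := 2 * √(I.T * (I.B * (C * d))) + I.cost C (I.B - 1) 1 2 with hR
  have hR0 : 0 ≤ R := by
    have := I.cost_nonneg hI (I.B - 1) 1 2 zero_le_two
    positivity
  let Bad : Set Ω := {ω | ¬ I.Good θ (rewards θ η ω) (I.B - 1) 1 0 I.arms}
  have hBad : MeasurableSet Bad :=
    (measurableSet_good I θ (I.B - 1) 1 0 I.arms fun s _ => hη s).compl
  have hT := hI.one_le_T_real
  have hK := hI.one_le_card_real
  have hprob : P.real Bad ≤ I.B / (I.T : ℝ) ^ 2 := by
    refine (prob_not_good_le hI hη hind hlaw hθ (I.B - 1) 1 0 I.arms hI.arms_nonempty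
      (Finset.Subset.refl _)).trans ?_
    have h1 : (I.arms.card : ℝ) * I.delta = 1 / (I.T : ℝ) ^ 2 := by
      rw [Input.delta]; field_simp
    have h2 : ((I.B - 1 : ℕ) : ℝ) ≤ I.B := by exact_mod_cast Nat.sub_le _ _
    rw [h1, mul_one_div]
    gcongr
  have hint : Integrable (Bad.indicator fun _ => (I.T * 2 : ℝ)) P :=
    (integrable_const _).indicator hBad
  have h := integral_mono (μ := P) (f := fun ω => I.T * inner ℝ b θ - R
      - Bad.indicator (fun _ => (I.T * 2 : ℝ)) ω)
    ((integrable_const _).sub hint) (hI.integrable_gain (η := η) hθ hη) fun ω => by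
      change I.T * inner ℝ b θ - R - Bad.indicator (fun _ => (I.T * 2 : ℝ)) ω ≤ I.gain θ η ω
      by_cases hω : ω ∈ Bad
      · rw [Set.indicator_of_mem hω]
        linarith [hI.mul_sub_gain_le (η := η) hθ hb ω]
      · rw [Set.indicator_of_notMem hω]
        linarith [hI.mul_sub_gain_le_of_good (η := η) hθ hb hmax (not_not.1 hω)]
  rw [integral_sub (integrable_const _) hint, integral_const, probReal_univ, one_smul,
    integral_indicator_const _ hBad, smul_eq_mul] at h
  have h3 : P.real Bad * (I.T * 2) ≤ 2 * (I.B / I.T) := by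
    calc P.real Bad * (I.T * 2) ≤ I.B / (I.T : ℝ) ^ 2 * (I.T * 2) := by gcongr
      _ = 2 * (I.B / I.T) := by field_simp
  rw [Input.regret, hsup]
  linarith

end Expectation

/-! ### Evaluation of the bound -/

namespace Input.IsValid

variable {I : Input d} {C : ℝ}

theorem half_le_log (hI : I.IsValid C) : 1 / 2 ≤ Real.log (I.arms.card * I.T) := by
  have := Real.log_le_log two_pos hI.two_le_real
  linarith [Real.log_two_gt_d9]

theorem half_le_sqrt (hI : I.IsValid C) :
    1 / 2 ≤ √(d * I.T * Real.log (I.arms.card * I.T)) := by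
  have hlog := hI.half_le_log
  have hdT : (1 : ℝ) ≤ d * I.T :=
    one_le_mul_of_one_le_of_one_le hI.one_le_d_real hI.one_le_T_real
  refine Real.le_sqrt_of_sq_le ?_
  linarith [le_mul_of_one_le_left (by linarith) hdT (b := Real.log (I.arms.card * I.T))]

theorem q_pow_B (hI : I.IsValid C) : I.q ^ I.B = I.T / I.c := by
  have hT := hI.one_le_T_real
  have hB := hI.one_le_B
  rw [Input.q, one_div, Real.rpow_inv_natCast_pow (div_nonneg (by linarith) hI.c_pos.le) (by omega)]

theorem q_le (hI : I.IsValid C) : I.q ≤ max 1 (1 / I.c) * (I.T : ℝ) ^ (1 / (I.B : ℝ)) := by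
  have hc := hI.c_pos
  have hB : (1 : ℝ) ≤ I.B := by exact_mod_cast hI.one_le_B
  rw [Input.q, div_eq_mul_one_div, mul_comm, Real.mul_rpow (by positivity) (Nat.cast_nonneg _)]
  gcongr
  calc (1 / I.c) ^ (1 / (I.B : ℝ)) ≤ (max 1 (1 / I.c)) ^ (1 / (I.B : ℝ)) := by
        gcongr; exact le_max_right _ _
    _ ≤ (max 1 (1 / I.c)) ^ (1 : ℝ) := by
        refine Real.rpow_le_rpow_of_exponent_le (le_max_left _ _) ?_
        rw [div_le_one (by linarith)]; exact hB
    _ = _ := Real.rpow_one _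

end Input.IsValid

/-- The batches have geometrically growing contributions `q ^ (i + 1) ε_i`, so that their sum is of
the order of the last one. -/
theorem Input.cost_eq (I : Input d) (C : ℝ) {s : ℝ} (hs : 1 < s) (hsq : s ^ 2 = I.q) (m : ℕ) : ∀ i,
    I.cost C m (i + 1) (4 * I.eps i)
      = 4 * √(d * Real.log (I.arms.card * (I.T : ℝ) ^ 2))
        * (C * ((s ^ (i + 2 + m) - s ^ (i + 2)) / (s - 1)) + I.T / s ^ (i + m)) := by
  have hs0 : 0 < s := by linarith
  have hs1 : s - 1 ≠ 0 := by linarith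
  have heps : ∀ i, I.eps i = √(d * Real.log (I.arms.card * (I.T : ℝ) ^ 2)) / s ^ i := by
    intro i
    have : I.q ^ i = (s ^ i) ^ 2 := by rw [← hsq]; ring
    rw [Input.eps, this, Real.sqrt_div' _ (by positivity), Real.sqrt_sq (by positivity)]
  induction m with
  | zero =>
    intro i
    rw [Input.cost, heps]
    simp only [add_zero, sub_self, zero_div, mul_zero, zero_add]
    ring
  | succ m ih =>
    intro i
    rw [Input.cost, ih (i + 1), heps, ← hsq]
    have e1 : s ^ (i + 1 + 2 + m) = s ^ (i + 2 + (m + 1)) := by ring_nf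
    have e2 : s ^ (i + 1 + m) = s ^ (i + (m + 1)) := by ring_nf
    rw [e1, e2]
    field_simp
    ring

/-- The constant of the regret bound when there are at most `κ (1 + log T)` batches. The second
summand takes care of the horizons below `exp (1 + 2 |log c|)`, the last two of the batches with at
most `C d` rounds and of the runs with an inaccurate estimate, the others of `Input.cost`. -/
noncomputable def regretConst (c C κ : ℝ) : ℝ :=
  4 + 4 * Real.exp (1 + 2 * |Real.log c|) + 4 * C * max 1 (1 / c)
    + 8 * C / √c * (Real.exp (1 / (4 * κ)) / (Real.exp (1 / (4 * κ)) - 1))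
    + 8 * √c * max 1 (1 / c) + 2 * √(3 * κ * C) + 4 * κ

/-- If there are at most `κ (1 + log T)` batches and the horizon is not bounded in terms of `c`, then
the lengths of the batches grow at least by a constant factor. -/
theorem Input.IsValid.exp_le_q {I : Input d} {C κ : ℝ} (hI : I.IsValid C) (hκ : 0 < κ)
    (hB : (I.B : ℝ) ≤ κ * (1 + Real.log I.T))
    (hT : Real.exp (1 + 2 * |Real.log I.c|) ≤ I.T) : Real.exp (1 / (4 * κ)) ^ 2 ≤ I.q := by
  have hT1 := hI.one_le_T_real
  have hB1 : (1 : ℝ) ≤ I.B := by exact_mod_cast hI.one_le_B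
  have hlogT : 1 + 2 * |Real.log I.c| ≤ Real.log I.T :=
    (Real.le_log_iff_exp_le (by linarith)).2 hT
  have hlog : (1 + Real.log I.T) / 2 ≤ Real.log (I.T / I.c) := by
    rw [Real.log_div (by linarith) hI.c_pos.ne']
    linarith [le_abs_self (Real.log I.c)]
  rw [Input.q, Real.rpow_def_of_pos (div_pos (by linarith) hI.c_pos), ← Real.exp_nat_mul,
    Real.exp_le_exp, mul_one_div (Real.log _), le_div_iff₀ (by linarith)]
  refine le_trans ?_ hlog
  calc ((2 : ℕ) : ℝ) * (1 / (4 * κ)) * I.B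
      ≤ ((2 : ℕ) : ℝ) * (1 / (4 * κ)) * (κ * (1 + Real.log I.T)) := by gcongr
    _ = (1 + Real.log I.T) / 2 := by push_cast; field_simp; ring

/-- The cost in the regime in which the lengths of the batches grow geometrically, with factor at
least `g ^ 2`. -/
theorem Input.IsValid.cost_le {I : Input d} {C g : ℝ} (hI : I.IsValid C) (hg : 1 < g)
    (hgq : g ^ 2 ≤ I.q) :
    I.cost C (I.B - 1) 1 2 ≤ (4 + 4 * C * max 1 (1 / I.c) + 8 * C / √I.c * (g / (g - 1))
      + 8 * √I.c * max 1 (1 / I.c))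
        * ((I.T : ℝ) ^ (1 / (I.B : ℝ)) * √(d * I.T * Real.log (I.arms.card * I.T))) := by
  have hT := hI.one_le_T_real
  have hK := hI.one_le_card_real
  have hd := hI.one_le_d_real
  have hc := hI.c_pos
  have hC := hI.C_pos
  have hq := hI.q_pos
  set X := (I.T : ℝ) ^ (1 / (I.B : ℝ)) with hX
  set Y := √(d * I.T * Real.log (I.arms.card * I.T)) with hY
  set Γ := max 1 (1 / I.c)
  have hΓ : 1 ≤ Γ := le_max_left _ _
  have hX1 : 1 ≤ X := Real.one_le_rpow hT (by positivity)
  have hY1 : 1 / 2 ≤ Y := hI.half_le_sqrt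
  have hlog := hI.half_le_log
  have hG : 0 < g / (g - 1) := div_pos (by linarith) (by linarith)
  have hrest : 0 ≤ 4 * C * Γ + 8 * C / √I.c * (g / (g - 1)) + 8 * √I.c * Γ := by positivity
  have hXY : 0 ≤ X * Y := by positivity
  have hX2 : X ≤ 2 * (X * Y) := by
    linarith [mul_le_mul_of_nonneg_left hY1 (zero_le_one.trans hX1)]
  obtain ⟨n, hn⟩ : ∃ n, I.B = n + 1 := ⟨I.B - 1, by have := hI.one_le_B; omega⟩
  rw [hn, Nat.add_sub_cancel]
  cases n with
  | zero =>
    have hXT : X = I.T := by rw [hX, hn]; simp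
    rw [Input.cost, ← hXT]
    linarith [mul_nonneg hrest hXY]
  | succ n =>
    set s := √I.q with hs
    have hsq : s ^ 2 = I.q := Real.sq_sqrt hq.le
    have hgs : g ≤ s := Real.le_sqrt_of_sq_le hgq
    have hs1 : 1 < s := hg.trans_le hgs
    have hsB : s ^ (n + 2) = √(I.T / I.c) := by
      rw [← hI.q_pow_B, ← hsq, ← pow_mul, mul_comm 2, pow_mul, Real.sqrt_sq (by positivity), hn]
    -- Here `ε_i = D / s ^ i`.
    set D := √(d * Real.log (I.arms.card * (I.T : ℝ) ^ 2)) with hD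
    have hDY : D * √I.T ≤ 2 * Y := by
      rw [hD, hY, ← Real.sqrt_mul' _ (by linarith)]
      refine Real.sqrt_le_iff.2 ⟨by positivity, ?_⟩
      rw [mul_pow, Real.sq_sqrt (by positivity)]
      have h1 : Real.log (I.arms.card * (I.T : ℝ) ^ 2) ≤ 2 * Real.log (I.arms.card * I.T) := by
        have h := Real.log_pow ((I.arms.card : ℝ) * I.T) 2
        push_cast at h
        rw [← h]
        refine Real.log_le_log (by positivity) ?_
        rw [mul_pow]
        gcongr
        exact le_self_pow₀ hK two_ne_zero
      have h2 : (0 : ℝ) ≤ d * I.T := by positivity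
      have h3 : (0 : ℝ) ≤ d * I.T * Real.log (I.arms.card * I.T) := by positivity
      linarith [mul_le_mul_of_nonneg_left h1 h2]
    have hsΓ : s ≤ Γ * X := by
      refine le_trans ?_ hI.q_le
      rw [← hsq]
      exact le_self_pow₀ hs1.le two_ne_zero
    have hss : s / (s - 1) ≤ g / (g - 1) := by
      rw [div_le_div_iff₀ (by linarith) (by linarith)]
      linarith
    have hsqT : √(I.T / I.c) = √I.T / √I.c := Real.sqrt_div' _ hc.le
    have hTs : 0 < √(I.T : ℝ) := Real.sqrt_pos.2 (by linarith)
    have hcs : 0 < √I.c := Real.sqrt_pos.2 hc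
    have hTT : √(I.T : ℝ) * √I.T = I.T := Real.mul_self_sqrt (by linarith)
    have hfirst : (s ^ (1 + 2 + n) - s ^ (1 + 2)) / (s - 1) ≤ √I.T / √I.c * (g / (g - 1)) := by
      calc (s ^ (1 + 2 + n) - s ^ (1 + 2)) / (s - 1) ≤ s ^ (1 + 2 + n) / (s - 1) := by
            have : 0 < s - 1 := by linarith
            gcongr
            exact sub_le_self _ (by positivity)
        _ = s ^ (n + 2) * (s / (s - 1)) := by ring
        _ ≤ √I.T / √I.c * (g / (g - 1)) := by rw [hsB, hsqT]; gcongr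
    have hlast : I.T / s ^ (1 + n) = √I.c * √I.T * s := by
      have h1 : s ^ (1 + n) = s ^ (n + 2) / s := by field_simp; ring
      rw [h1, hsB, hsqT]
      nth_rewrite 1 [← hTT]
      field_simp
    rw [Input.cost, Input.cost_eq I C hs1 hsq, hlast, pow_one]
    have hD0 : 0 ≤ D := Real.sqrt_nonneg _
    calc C * I.q * 2 + 4 * D * (C * ((s ^ (1 + 2 + n) - s ^ (1 + 2)) / (s - 1)) + √I.c * √I.T * s)
        ≤ C * (Γ * X) * 2 + 4 * D * (C * (√I.T / √I.c * (g / (g - 1)))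
            + √I.c * √I.T * (Γ * X)) := by
          gcongr
          exact hI.q_le
      _ = 2 * C * Γ * X + (4 * C / √I.c * (g / (g - 1)) + 4 * √I.c * Γ * X) * (D * √I.T) := by
          ring
      _ ≤ 2 * C * Γ * (2 * (X * Y))
            + (4 * C / √I.c * (g / (g - 1)) * X + 4 * √I.c * Γ * X) * (2 * Y) := by
          have : 4 * C / √I.c * (g / (g - 1)) ≤ 4 * C / √I.c * (g / (g - 1)) * X :=
            le_mul_of_one_le_right (by positivity) hX1
          gcongr
      _ = (4 * C * Γ + 8 * C / √I.c * (g / (g - 1)) + 8 * √I.c * Γ) * (X * Y) := by ring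
      _ ≤ _ := by gcongr; linarith

theorem Input.IsValid.regret_le {Ω : Type*} [MeasurableSpace Ω] {P : Measure Ω}
    [IsProbabilityMeasure P] {I : Input d} {C κ : ℝ} {θ : Vec d} {η : ℕ → Ω → ℝ}
    (hI : I.IsValid C) (hθ : ‖θ‖ ≤ 1) (hη : ∀ t, Measurable (η t)) (hind : iIndepFun η P)
    (hlaw : ∀ t, IsNoiseLaw (P.map (η t))) (hκ : 0 < κ)
    (hB : (I.B : ℝ) ≤ κ * (1 + Real.log I.T)) :
    I.regret P θ η ≤ regretConst I.c C κ
      * ((I.T : ℝ) ^ (1 / (I.B : ℝ)) * √(d * I.T * Real.log (I.arms.card * I.T))) := by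
  have hT := hI.one_le_T_real
  have hK := hI.one_le_card_real
  have hd := hI.one_le_d_real
  have hc := hI.c_pos
  have hC := hI.C_pos
  have hlog2 := hI.half_le_log
  have hX1 : 1 ≤ (I.T : ℝ) ^ (1 / (I.B : ℝ)) := Real.one_le_rpow hT (by positivity)
  have hY1 := hI.half_le_sqrt
  have hcost := fun hgq => hI.cost_le (g := Real.exp (1 / (4 * κ)))
    (Real.one_lt_exp_iff.2 (by positivity)) hgq
  have hG : 0 < Real.exp (1 / (4 * κ)) / (Real.exp (1 / (4 * κ)) - 1) :=
    div_pos (Real.exp_pos _) (sub_pos.2 (Real.one_lt_exp_iff.2 (by positivity)))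
  rw [regretConst]
  set X := (I.T : ℝ) ^ (1 / (I.B : ℝ))
  set Y := √(d * I.T * Real.log (I.arms.card * I.T)) with hY
  set Γ := max 1 (1 / I.c)
  set G := Real.exp (1 / (4 * κ)) / (Real.exp (1 / (4 * κ)) - 1)
  set E := Real.exp (1 + 2 * |Real.log I.c|) with hE
  have hE0 : 0 < E := Real.exp_pos _
  have hΓ : 1 ≤ Γ := le_max_left _ _
  have hYXY : Y ≤ X * Y := le_mul_of_one_le_left (by linarith) hX1
  have hXY : 1 ≤ 2 * (X * Y) := by linarith
  rcases lt_or_ge (I.T : ℝ) E with hTE | hTE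
  · have hrest : 0 ≤ 4 + 4 * C * Γ + 8 * C / √I.c * G + 8 * √I.c * Γ + 2 * √(3 * κ * C)
        + 4 * κ := by positivity
    have h1 := hI.regret_le_two_mul (P := P) hθ hη
    have h2 := mul_le_mul_of_nonneg_left hXY hE0.le
    have h3 := mul_nonneg hrest (by linarith : 0 ≤ X * Y)
    linarith
  · have h1 := hI.regret_le_cost hθ hη hind hlaw
    have h2 := hcost (hI.exp_le_q hκ hB hTE)
    have hlogT : 1 + Real.log I.T ≤ 3 * Real.log (I.arms.card * I.T) := by
      have : Real.log I.T ≤ Real.log (I.arms.card * I.T) :=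
        Real.log_le_log (by linarith) (le_mul_of_one_le_left (by linarith) hK)
      linarith
    have h3 : √(I.T * (I.B * (C * d))) ≤ √(3 * κ * C) * Y := by
      rw [hY, ← Real.sqrt_mul (by positivity)]
      refine Real.sqrt_le_sqrt ?_
      calc (I.T : ℝ) * (I.B * (C * d)) ≤ I.T * (κ * (3 * Real.log (I.arms.card * I.T)) * (C * d)) := by
            gcongr
            exact hB.trans (by gcongr)
        _ = _ := by ring
    have h4 : I.B / (I.T : ℝ) ≤ κ := by
      rw [div_le_iff₀ (by linarith)]
      refine hB.trans ?_
      gcongr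
      linarith [Real.log_le_sub_one_of_pos (by linarith : (0 : ℝ) < I.T)]
    have h5 : √(3 * κ * C) * Y ≤ √(3 * κ * C) * (X * Y) := by gcongr
    have h6 : κ ≤ κ * (2 * (X * Y)) := le_mul_of_one_le_right hκ.le hXY
    have h7 : 0 ≤ 4 * E * (X * Y) := by positivity
    linarith

theorem regretConst_nonneg {c C κ : ℝ} (hC : 0 < C) (hκ : 0 < κ) : 0 ≤ regretConst c C κ := by
  have hG : 0 < Real.exp (1 / (4 * κ)) / (Real.exp (1 / (4 * κ)) - 1) :=
    div_pos (Real.exp_pos _) (sub_pos.2 (Real.one_lt_exp_iff.2 (by positivity)))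
  have hΓ : 0 < max 1 (1 / c) := lt_max_of_lt_left one_pos
  rw [regretConst]
  positivity

theorem Input.IsValid.achieves {Ω : Type*} [MeasurableSpace Ω] {P : Measure Ω}
    [IsProbabilityMeasure P] {I : Input d} {C R : ℝ} {θ : Vec d} {η : ℕ → Ω → ℝ} {B : ℕ}
    (hI : I.IsValid C) (hθ : ‖θ‖ ≤ 1) (hη : ∀ t, Measurable (η t)) (hB : I.B ≤ B)
    (hR : I.regret P θ η ≤ R) : I.Achieves P θ η B R where
  batches_le ω := by
    have h := I.length_batchesFrom_le (rewards θ η ω) (I.B - 1) 1 0 I.arms 0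
    have h1 := hI.one_le_B
    rw [Input.batches]
    omega
  rounds := I.length_played θ η
  mem_arms := hI.mem_arms
  integrable := hI.integrable_gain hθ hη
  regret_le := hR

/-- With `1 + ⌊log T⌋` batches the factor `T ^ (1 / B)` is already bounded. -/
theorem rpow_one_div_min_le {T B : ℕ} (hT : 1 ≤ T) :
    (T : ℝ) ^ (1 / ((min B (1 + ⌊Real.log T⌋₊) : ℕ) : ℝ))
      ≤ Real.exp 1 * (T : ℝ) ^ (1 / (B : ℝ)) := by
  have hT' : (1 : ℝ) ≤ T := by exact_mod_cast hT
  have hX1 : 1 ≤ (T : ℝ) ^ (1 / (B : ℝ)) := Real.one_le_rpow hT' (by positivity)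
  have he : 1 ≤ Real.exp 1 := Real.one_le_exp zero_le_one
  rcases le_total B (1 + ⌊Real.log T⌋₊) with h | h
  · rw [min_eq_left h]
    exact le_mul_of_one_le_left (by linarith) he
  · rw [min_eq_right h]
    refine le_trans ?_ (le_mul_of_one_le_right (Real.exp_pos _).le hX1)
    rw [Real.rpow_def_of_pos (by linarith), Real.exp_le_exp, mul_one_div,
      div_le_one (by positivity)]
    push_cast
    linarith [Nat.lt_floor_add_one (Real.log T)]

end BatchedLinearBandit

open BatchedLinearBandit
theorem theorem2 :
    (∃ c C : ℝ, 0 < c ∧ c ≤ C ∧ ∀ d : ℕ,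
      ∃ D : Finset (Vec d) → ℝ → ℝ → List (Vec d), IsDesignRule c C D ∧
        ∀ A : Finset (Vec d), A.Nonempty → ∀ ε δ : ℝ, 0 < ε → 0 < δ → δ ≤ 1 / 2 →
          IsApproxGOptimal A (D A ε δ)) ∧
    (∀ c C κ : ℝ, 0 < c → c ≤ C → ∃ M : ℝ,
      ∀ (d : ℕ) (A : Finset (Vec d)) (T B : ℕ)
        (D : Finset (Vec d) → ℝ → ℝ → List (Vec d)) (tie : Finset (Vec d) → Vec d)
        (Ω : Type*) [MeasurableSpace Ω] (P : Measure Ω) [IsProbabilityMeasure P]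
        (θ : Vec d) (η : ℕ → Ω → ℝ),
        1 ≤ d → 1 ≤ B → 2 ≤ A.card * T → (∀ a ∈ A, ‖a‖ ≤ 1) → ‖θ‖ ≤ 1 →
        IsDesignRule c C D → (∀ S : Finset (Vec d), S.Nonempty → tie S ∈ S) →
        (∀ t, Measurable (η t)) → iIndepFun η P → (∀ t, IsNoiseLaw (P.map (η t))) →
        ((B : ℝ) ≤ κ * (1 + Real.log T) →
          Input.Achieves ⟨A, T, B, c, D, tie⟩ P θ η B
            (M * ((T : ℝ) ^ (1 / (B : ℝ)) * Real.sqrt (d * T * Real.log (A.card * T))))) ∧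
        Input.Achieves ⟨A, T, min B (1 + ⌊Real.log T⌋₊), c, D, tie⟩ P θ η B
          (M * ((T : ℝ) ^ (1 / (B : ℝ)) * Real.sqrt (d * T * Real.log (A.card * T))))) := by
  refine ⟨⟨8, 9, by norm_num, by norm_num, exists_designRule⟩, fun c C κ hc hcC => ?_⟩
  have hC : 0 < C := hc.trans_le hcC
  refine ⟨max (regretConst c C κ) (regretConst c C 1 * Real.exp 1), ?_⟩
  intro d A T B D tie Ω _ P _ θ η hd hB hKT hA hθ hD htie hη hind hlaw
  have hvalid : ∀ B' : ℕ, 1 ≤ B' → Input.IsValid ⟨A, T, B', c, D, tie⟩ C := fun B' hB' =>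
    ⟨hd, hB', hKT, hA, hc, hcC, hD, htie⟩
  have hT : 1 ≤ T := (hvalid B hB).one_le_T
  have hlogT : 0 ≤ Real.log T := Real.log_nonneg (by exact_mod_cast hT)
  refine ⟨fun hBκ => ?_, ?_⟩
  · have hκ : 0 < κ := by
      by_contra hκ
      have h1 : (1 : ℝ) ≤ B := by exact_mod_cast hB
      nlinarith
    refine (hvalid B hB).achieves hθ hη le_rfl
      (((hvalid B hB).regret_le hθ hη hind hlaw hκ hBκ).trans ?_)
    gcongr
    exact le_max_left _ _
  · have hB' : 1 ≤ min B (1 + ⌊Real.log T⌋₊) := le_min hB (Nat.le_add_right _ _)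
    have hle : ((min B (1 + ⌊Real.log T⌋₊) : ℕ) : ℝ) ≤ 1 * (1 + Real.log T) := by
      have h1 : ((min B (1 + ⌊Real.log T⌋₊) : ℕ) : ℝ) ≤ ((1 + ⌊Real.log T⌋₊ : ℕ) : ℝ) :=
        Nat.cast_le.2 (min_le_right _ _)
      have h2 := Nat.floor_le hlogT
      rw [Nat.cast_add, Nat.cast_one] at h1
      linarith
    refine (hvalid _ hB').achieves hθ hη (min_le_left _ _)
      (((hvalid _ hB').regret_le hθ hη hind hlaw one_pos hle).trans ?_)
    calc regretConst c C 1 * ((T : ℝ) ^ (1 / ((min B (1 + ⌊Real.log T⌋₊) : ℕ) : ℝ))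
          * √(d * T * Real.log (A.card * T)))
        ≤ regretConst c C 1 * (Real.exp 1 * (T : ℝ) ^ (1 / (B : ℝ))
          * √(d * T * Real.log (A.card * T))) := by
          have := regretConst_nonneg (c := c) hC one_pos
          gcongr
          exact rpow_one_div_min_le hT
      _ = regretConst c C 1 * Real.exp 1
          * ((T : ℝ) ^ (1 / (B : ℝ)) * √(d * T * Real.log (A.card * T))) := by ring
      _ ≤ _ := by
          gcongr
          exact le_max_right _ _
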